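/- Theorem 5 (integral formula). Let $M$ be a closed Riemannian manifold of dimension $n+p$ (smooth, compact, without boundary; an orientation is not needed, and if $M$ is oriented then integration against the Riemannian measure $d\nu$ is integration against the Riemannian volume form). Let $\nabla$ be its Levi-Civita connection and $R(X,Y,Z,W)=\langle\nabla_X\nabla_YZ-\nabla_Y\nabla_XZ-\nabla_{[X,Y]}Z,W\rangle$. Let $\mathcal F$ and $\mathcal F^\perp$ be two orthogonal $C^\infty$ foliations of $M$ of complementary codimensions $p$ and $n$. Indices $i,j$ run over $1,\dots,n$ and $\alpha,\beta$ over $n+1,\dots,n+p$. On a neighbourhood $U_x$ of each point $x\in M$ let a smooth orthonormal adapted frame $e_1,\dots,e_{n+p}$ be given, that is, the $e_i$ are tangent to $\mathcal F$ and the $e_\alpha$ are tangent to $\mathcal F^\perp$. Fix $\alpha$ and assume that on $U_x\cap U_y$ the fields $e_\alpha$ of the frames on $U_x$ and $U_y$ agree up to sign at every point, for all $x,y\in M$; thus $\nabla_{e_\alpha}e_\alpha$ is a vector field on all of $M$. (This holds, for instance, if $e_\alpha$ is a member of each frame that is defined on all of $M$, and always if $p=1$.) Put $$X^\perp=\sum_\beta\langle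 X,e_\beta\rangle e_\beta,\qquad h=\sum_i(\nabla_{e_i}e_i)^\perp,\qquad \|H_{\mathcal F}^\alpha\|^2=\sum_{i,j}\langle-\nabla_{e_i}e_\alpha,e_j\rangle^2,\qquad \mathrm{Tr}(K^\alpha_{ij})=\sum_iR(e_\alpha,e_i,e_i,e_\alpha),$$ $$H^i_{\mathcal F^\perp}(X,Y)=\langle-\nabla_Xe_i,Y\rangle\ \text{ for } X,Y \text{ tangent to }\mathcal F^\perp,\qquad \mathrm{div}_{\mathcal F^\perp}(X)=\sum_\beta\langle e_\beta,\nabla_{e_\beta}X\rangle,\qquad \nabla^\perp_{e_i}e_\alpha=(\nabla_{e_i}e_\alpha)^\perp.$$ Then the function on $M$ whose value at $x$ is that of $$e_\alpha\langle h,e_\alpha\rangle-\|H_{\mathcal F}^\alpha\|^2-\mathrm{Tr}(K^\alpha_{ij})-\sum_{i=1}^nH^i_{\mathcal F^\perp}\bigl(e_\alpha,\nabla^\perp_{e_i}e_\alpha-[e_\alpha,e_i]^\perp\bigr)-\mathrm{div}_{\mathcal F^\perp}(\nabla_{e_\alpha}e_\alpha)$$ at $x$, computed in the frame on $U_x$,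 is integrable, and $$\int_M\Bigl(e_\alpha\langle h,e_\alpha\rangle-\|H_{\mathcal F}^\alpha\|^2-\mathrm{Tr}(K^\alpha_{ij})-\sum_{i=1}^nH^i_{\mathcal F^\perp}\bigl(e_\alpha,\nabla^\perp_{e_i}e_\alpha-[e_\alpha,e_i]^\perp\bigr)-\mathrm{div}_{\mathcal F^\perp}(\nabla_{e_\alpha}e_\alpha)\Bigr)d\nu=0.$$ -/

import Mathlib

open MeasureTheory Manifold Bundle
open scoped ContDiff Topology

noncomputable section

namespace RiemFol

/-! ### Vector fields, the Levi-Civita connection and the curvature -/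

section Geometry

variable {m : ℕ} {M : Type*} [TopologicalSpace M] [ChartedSpace (EuclideanSpace ℝ (Fin m)) M]

/-- A (not necessarily smooth) vector field on the `m`-dimensional manifold `M`. A vector field on
an open set `U` is represented by any extension to `M`. -/
abbrev VField (m : ℕ) (M : Type*) [TopologicalSpace M]
    [ChartedSpace (EuclideanSpace ℝ (Fin m)) M] : Type _ :=
  (x : M) → TangentSpace (𝓡 m) x

/-- The vector field `X` is of class `C^∞` on `U`. -/
def SmoothOn (X : VField m M) [IsManifold (𝓡 m) ∞ M] (U : Set M) : Prop :=
  ContMDiffOn (𝓡 m) (𝓡 m).tangent ∞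
    (fun x ↦ (⟨x, X x⟩ : TangentBundle (𝓡 m) M)) U

/-- `X f`, the derivative of the function `f` along the vector field `X`. -/
def dirDeriv (X : VField m M) (f : M → ℝ) (x : M) : ℝ :=
  mvfderiv (𝓡 m) f x (X x)

/-- The Lie bracket `[X, Y]`. -/
abbrev bracket (X Y : VField m M) : VField m M :=
  VectorField.mlieBracket (𝓡 m) X Y

variable [RiemannianBundle (fun x : M ↦ TangentSpace (𝓡 m) x)]

/-- The function `⟨X, Y⟩`. -/
def ip (X Y : VField m M) (x : M) : ℝ := inner ℝ (X x) (Y x)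

/-- The right-hand side of the Koszul formula for `2 ⟨∇_X Y, Z⟩`. -/
def koszul (X Y Z : VField m M) (x : M) : ℝ :=
  dirDeriv X (ip Y Z) x + dirDeriv Y (ip Z X) x - dirDeriv Z (ip X Y) x
    + ip (bracket X Y) Z x - ip (bracket X Z) Y x - ip (bracket Y Z) X x

variable [IsManifold (𝓡 m) ∞ M]

instance finiteDimensional_tangentSpace (x : M) :
    FiniteDimensional ℝ (TangentSpace (𝓡 m) x) :=
  inferInstanceAs (FiniteDimensional ℝ (EuclideanSpace ℝ (Fin m)))

/-- The Levi-Civita connection `∇_X Y`: the value at `x` is the vector whose inner product with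
every `z ∈ T_x M` is half the Koszul expression of `X`, `Y` and any extension of `z`, written in an
orthonormal basis of `T_x M`. -/
def nabla (X Y : VField m M) : VField m M := fun x ↦
  ∑ k, ((1 / 2 : ℝ) * koszul X Y
    (FiberBundle.extend (EuclideanSpace ℝ (Fin m))
      (stdOrthonormalBasis ℝ (TangentSpace (𝓡 m) x) k)) x) •
    stdOrthonormalBasis ℝ (TangentSpace (𝓡 m) x) k

/-- `R(X, Y, Z, W) = ⟨∇_X ∇_Y Z - ∇_Y ∇_X Z - ∇_[X, Y] Z, W⟩`. -/
def curv (X Y Z W : VField m M) : M → ℝ :=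
  ip (fun x ↦ nabla X (nabla Y Z) x - nabla Y (nabla X Z) x - nabla (bracket X Y) Z x) W

/-! ### The Riemannian measure -/

/-- The Gram determinant `det (g_ij)` at the point with coordinates `v` in the preferred chart
at `c`, where `g_ij = ⟨∂_i, ∂_j⟩` and `∂_i` are the coordinate vector fields. -/
def gramDet (c : M) (v : EuclideanSpace ℝ (Fin m)) : ℝ :=
  Matrix.det (Matrix.of fun i j : Fin m ↦
    (inner ℝ
      ((mfderiv (𝓡 m) (𝓡 m) (chartAt (EuclideanSpace ℝ (Fin m)) c).symm v
        (EuclideanSpace.single i (1 : ℝ))) :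
        TangentSpace (𝓡 m) ((chartAt (EuclideanSpace ℝ (Fin m)) c).symm v))
      (mfderiv (𝓡 m) (𝓡 m) (chartAt (EuclideanSpace ℝ (Fin m)) c).symm v
        (EuclideanSpace.single j (1 : ℝ))) : ℝ))

/-- The measure `√(det g) dv¹ ⋯ dvᵐ` on the domain of the preferred chart at `c`, extended by
zero to `M`. -/
def chartVolume [MeasurableSpace M] (c : M) : Measure M :=
  (((volume : Measure (EuclideanSpace ℝ (Fin m))).restrict
      (chartAt (EuclideanSpace ℝ (Fin m)) c).target).withDensity
    fun v ↦ ENNReal.ofReal (√(gramDet c v))).map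
    (chartAt (EuclideanSpace ℝ (Fin m)) c).symm

variable (m M) in
/-- The Riemannian measure `dν` of `M`. The measures `chartVolume c` agree on the overlaps of their
chart domains, so that their supremum is the measure on `M` that restricts to `chartVolume c` on
the chart domain at `c`, for each `c`. -/
def riemannianVolume [MeasurableSpace M] : Measure M :=
  ⨆ c : M, chartVolume (m := m) c

end Geometry

/-! ### Foliations -/

/-- A `C^∞` foliation with leaves of dimension `k` and codimension `q` on the `m`-dimensional
manifold `M`, given by a foliated atlas: smooth charts with values in `ℝ^k × ℝ^q` that cover `M`
and whose changes of coordinates are locally of the form `(u, v) ↦ (f (u, v), g v)`. -/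
structure Foliation (m k q : ℕ) (M : Type*) [TopologicalSpace M]
    [ChartedSpace (EuclideanSpace ℝ (Fin m)) M] where
  charts : Set (OpenPartialHomeomorph M
    (EuclideanSpace ℝ (Fin k) × EuclideanSpace ℝ (Fin q)))
  smooth : ∀ φ ∈ charts,
    ContMDiffOn (𝓡 m) 𝓘(ℝ, EuclideanSpace ℝ (Fin k) × EuclideanSpace ℝ (Fin q)) ∞ φ φ.source
  smooth_symm : ∀ φ ∈ charts,
    ContMDiffOn 𝓘(ℝ, EuclideanSpace ℝ (Fin k) × EuclideanSpace ℝ (Fin q)) (𝓡 m) ∞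
      φ.symm φ.target
  cover : ∀ x : M, ∃ φ ∈ charts, x ∈ φ.source
  compatible : ∀ φ ∈ charts, ∀ ψ ∈ charts, ∀ x ∈ φ.source ∩ ψ.source,
    ∃ W ∈ 𝓝 x, ∀ y ∈ W, ∀ z ∈ W, (φ y).2 = (φ z).2 → (ψ y).2 = (ψ z).2

section Fol

variable {m k q n p : ℕ} {M : Type*} [TopologicalSpace M]
  [ChartedSpace (EuclideanSpace ℝ (Fin m)) M]

/-- The vector `v` at `x` is tangent to the leaf through `x`: the transverse coordinates of the
foliated charts have derivative zero in the direction `v`. -/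
def Foliation.IsTangent (F : Foliation m k q M) {x : M} (v : TangentSpace (𝓡 m) x) : Prop :=
  ∀ φ ∈ F.charts, x ∈ φ.source →
    mfderiv (𝓡 m) (𝓡 q) (fun y ↦ (φ y).2) x v = 0

variable [RiemannianBundle (fun x : M ↦ TangentSpace (𝓡 m) x)]

/-- The foliations `F` and `G` are orthogonal. -/
def Foliation.Orthogonal (F : Foliation m n p M) (G : Foliation m p n M) : Prop :=
  ∀ (x : M) (v w : TangentSpace (𝓡 m) x), F.IsTangent v → G.IsTangent w → inner ℝ v w = 0

variable [IsManifold (𝓡 m) ∞ M]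

/-- `e_1, …, e_n` (the family `e`) and `e_{n+1}, …, e_{n+p}` (the family `u`) form a smooth
orthonormal frame on the open set `U`, with the `e_i` tangent to `F` and the `u_α` tangent
to `G`. -/
structure IsAdaptedFrame (F : Foliation m n p M) (G : Foliation m p n M) (U : Set M)
    (e : Fin n → VField m M) (u : Fin p → VField m M) : Prop where
  isOpen : IsOpen U
  smooth_e : ∀ i, SmoothOn (e i) U
  smooth_u : ∀ α, SmoothOn (u α) U
  tangent_e : ∀ i, ∀ x ∈ U, F.IsTangent (e i x)
  tangent_u : ∀ α, ∀ x ∈ U, G.IsTangent (u α x)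
  inner_e : ∀ i j, ∀ x ∈ U, ip (e i) (e j) x = if i = j then 1 else 0
  inner_u : ∀ α β, ∀ x ∈ U, ip (u α) (u β) x = if α = β then 1 else 0
  inner_e_u : ∀ i α, ∀ x ∈ U, ip (e i) (u α) x = 0

/-- The component `X^⊥ = ∑_α ⟨X, e_α⟩ e_α` of `X` tangent to `F^⊥`. -/
def perp (u : Fin p → VField m M) (X : VField m M) : VField m M := fun x ↦
  ∑ α, ip X (u α) x • u α x

/-- The mean curvature vector `h = ∑_i (∇_{e_i} e_i)^⊥` of `F`. -/
def meanCurv (e : Fin n → VField m M) (u : Fin p → VField m M) : VField m M := fun x ↦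
  ∑ i, perp u (nabla (e i) (e i)) x

/-- The second fundamental form of `F` in the direction of a field `ν` normal to `F`,
`H_F^ν (X, Y) = ⟨-∇_X ν, Y⟩` for `X`, `Y` tangent to `F`. With the roles of the two foliations
exchanged, it is the second fundamental form of `F^⊥`: `H_{F^⊥}^i (X, Y) = ⟨-∇_X e_i, Y⟩` for `X`,
`Y` tangent to `F^⊥`. -/
def secondForm (ν X Y : VField m M) : M → ℝ := ip (fun x ↦ -nabla X ν x) Y

/-- `‖H_F^α‖² = ∑_{i, j} H_F^α (e_i, e_j)²`. -/
def normSqSecondForm (e : Fin n → VField m M) (ν : VField m M) (x : M) : ℝ :=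
  ∑ i, ∑ j, secondForm ν (e i) (e j) x ^ 2

/-- `Tr (K^α_{ij}) = ∑_i R(e_α, e_i, e_i, e_α)`. -/
def traceK (e : Fin n → VField m M) (ν : VField m M) (x : M) : ℝ :=
  ∑ i, curv ν (e i) (e i) ν x

/-- `∑_a ⟨f_a, ∇_{f_a} X⟩`, the divergence of `X` along the foliation framed by the family `f`. -/
def divAlong {r : ℕ} (f : Fin r → VField m M) (X : VField m M) (x : M) : ℝ :=
  ∑ a, ip (f a) (nabla (f a) X) x

/-- The function
`e_α⟨h, e_α⟩ - ‖H_F^α‖² - Tr (K^α_{ij}) - ∑_i H_{F^⊥}^i (e_α, ∇^⊥_{e_i} e_α - [e_α, e_i]^⊥)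
  - div_{F^⊥} (∇_{e_α} e_α)`. -/
def integrand (e : Fin n → VField m M) (u : Fin p → VField m M) (α : Fin p) (x : M) : ℝ :=
  dirDeriv (u α) (ip (meanCurv e u) (u α)) x
    - normSqSecondForm e (u α) x
    - traceK e (u α) x
    - ∑ i, secondForm (e i) (u α)
        (fun y ↦ perp u (nabla (e i) (u α)) y - perp u (bracket (u α) (e i)) y) x
    - divAlong u (nabla (u α) (u α)) x

end Fol

end RiemFol

end

/-!
Write `ν = e_α`. The integrand is, at every point, minus the divergence of the field `∇_ν ν`
(`IsAdaptedFrame.integrand_eq`). This field is globally defined and smooth, because a change of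
sign of `ν` does not affect it (`nabla_self_eq_of_eq_or_neg`), so that the theorem follows from the
divergence theorem on a closed manifold (`integral_divAlong`).

For the pointwise identity, expand `ν⟨h, ν⟩ = ∑_i ν⟨∇_{e_i} e_i, ν⟩` with the compatibility of `∇`
with the metric, introduce the curvature, and differentiate `⟨∇_ν e_i, ν⟩ + ⟨e_i, ∇_ν ν⟩ = 0` along
`e_i`. What remains are products of the coefficients of `∇_ν e_i`, `∇_{e_i} ν` and `[ν, e_i]` in the
frame. Since both foliations are integrable and orthogonal to each other, their second fundamental
forms are symmetric; all the products then cancel, except for `2 ∑_{i, j} ⟨∇_ν e_i, e_j⟩ H_{ij}`,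
which vanishes since the first factor is antisymmetric and `H` is symmetric. Integrability enters
through `Foliation.isTangent_bracket`: fields annihilating the transverse coordinates have a bracket
that annihilates them.

For the divergence theorem, the divergence of `X` in an orthonormal frame `E` is
`-∑_a ⟨[X, E_a], E_a⟩`, with no connection left. In a chart, the density `√(det g)` is the inverse
of `|det E|`, so Jacobi's formula gives `√(det g) div X = ∑_i ∂_i (√(det g) X^i)`
(`density_mul_divAlong`). A partition of unity and the vanishing of the integral of a compactly
supported Euclidean divergence finish the proof. That the Riemannian measure, a supremum of chart
measures, restricts to each of them (`restrict_riemannianVolume`) is the change of variables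
formula on the overlaps of the charts.
-/

noncomputable section

set_option linter.unusedSectionVars false

namespace RiemFol

section LocalGeometry

variable {m : ℕ} {M : Type*} [TopologicalSpace M] [ChartedSpace (EuclideanSpace ℝ (Fin m)) M]

section Calculus

variable {X Y Z : VField m M} {f g : M → ℝ} {x : M} {U : Set M}

/-! ### Smooth vector fields and directional derivatives -/

theorem dirDeriv_congr (h : f =ᶠ[𝓝 x] g) : dirDeriv X f x = dirDeriv X g x := by
  have h1 := h.mfderiv_eq (I := 𝓡 m) (I' := 𝓘(ℝ, ℝ))
  have : mvfderiv (𝓡 m) f x = mvfderiv (𝓡 m) g x := by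
    ext v
    exact congrArg (fun L : EuclideanSpace ℝ (Fin m) →L[ℝ] ℝ ↦ L v) h1
  simp [dirDeriv, this]

theorem dirDeriv_eq_zero_of_eventually_const {c : ℝ} (h : ∀ᶠ y in 𝓝 x, f y = c) :
    dirDeriv X f x = 0 := by
  rw [dirDeriv_congr (X := X) (g := fun _ ↦ c) h]
  simp [dirDeriv, mvfderiv_const]

theorem dirDeriv_mul (hf : MDifferentiableAt (𝓡 m) 𝓘(ℝ) f x)
    (hg : MDifferentiableAt (𝓡 m) 𝓘(ℝ) g x) :
    dirDeriv X (f * g) x = f x * dirDeriv X g x + g x * dirDeriv X f x := by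
  simp [dirDeriv, mvfderiv_mul hf hg]

theorem dirDeriv_add (hf : MDifferentiableAt (𝓡 m) 𝓘(ℝ) f x)
    (hg : MDifferentiableAt (𝓡 m) 𝓘(ℝ) g x) :
    dirDeriv X (f + g) x = dirDeriv X f x + dirDeriv X g x := by
  simp [dirDeriv, mvfderiv_add hf hg]

theorem dirDeriv_neg : dirDeriv X (-f) x = -dirDeriv X f x := by
  simp [dirDeriv, mvfderiv_neg]

theorem dirDeriv_sum {ι : Type*} (s : Finset ι) {f : ι → M → ℝ}
    (hf : ∀ i ∈ s, MDifferentiableAt (𝓡 m) 𝓘(ℝ) (f i) x) :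
    dirDeriv X (fun y ↦ ∑ i ∈ s, f i y) x = ∑ i ∈ s, dirDeriv X (f i) x := by
  classical
  have key : MDifferentiableAt (𝓡 m) 𝓘(ℝ) (fun y ↦ ∑ i ∈ s, f i y) x ∧
      dirDeriv X (fun y ↦ ∑ i ∈ s, f i y) x = ∑ i ∈ s, dirDeriv X (f i) x := by
    induction s using Finset.induction_on with
    | empty =>
      simp only [Finset.sum_empty]
      exact ⟨mdifferentiableAt_const, dirDeriv_eq_zero_of_eventually_const (c := 0) (by simp)⟩
    | insert a s ha ih =>
      obtain ⟨h1, h2⟩ := ih fun i hi ↦ hf i (Finset.mem_insert_of_mem hi)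
      have ha' := hf a (Finset.mem_insert_self _ _)
      simp only [Finset.sum_insert ha]
      exact ⟨ha'.add h1, by rw [← h2]; exact dirDeriv_add ha' h1⟩
  exact key.2

variable [IsManifold (𝓡 m) ∞ M]

/-- The vector field `X` is differentiable at `x`. -/
abbrev DiffAt (X : VField m M) (x : M) : Prop :=
  MDifferentiableAt (𝓡 m) (𝓡 m).tangent (fun y ↦ (⟨y, X y⟩ : TangentBundle (𝓡 m) M)) x

theorem SmoothOn.contMDiffAt (h : SmoothOn X U) (hU : IsOpen U) (hx : x ∈ U) :
    ContMDiffAt (𝓡 m) (𝓡 m).tangent ∞ (fun y ↦ (⟨y, X y⟩ : TangentBundle (𝓡 m) M)) x :=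
  ContMDiffOn.contMDiffAt h (hU.mem_nhds hx)

theorem SmoothOn.diffAt (h : SmoothOn X U) (hU : IsOpen U) (hx : x ∈ U) : DiffAt X x :=
  (h.contMDiffAt hU hx).mdifferentiableAt (by simp)

theorem SmoothOn.smul (hf : ContMDiffOn (𝓡 m) 𝓘(ℝ) ∞ f U) (hX : SmoothOn X U) :
    SmoothOn (f • X) U :=
  ContMDiffOn.smul_section hf hX

theorem SmoothOn.sum {ι : Type*} (s : Finset ι) {X : ι → VField m M}
    (hX : ∀ i, SmoothOn (X i) U) : SmoothOn (fun y ↦ ∑ i ∈ s, X i y) U :=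
  ContMDiffOn.sum_section fun i _ ↦ hX i

theorem SmoothOn.congr (hX : SmoothOn X U) (h : ∀ x ∈ U, Y x = X x) : SmoothOn Y U :=
  ContMDiffOn.congr hX fun x hx ↦ by rw [h x hx]

theorem SmoothOn.bracket (hU : IsOpen U) (hX : SmoothOn X U) (hY : SmoothOn Y U) :
    SmoothOn (bracket X Y) U := by
  intro x hx
  have : IsManifold (𝓡 m) (minSmoothness ℝ 2) M := by
    simp only [minSmoothness_of_isRCLikeNormedField]; infer_instance
  have : IsManifold (𝓡 m) (((⊤ : ℕ∞) : ℕ∞ω) + 1) M := by simpa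
  exact (ContMDiffAt.mlieBracket_vectorField (m := ⊤) (n := ⊤) (hX.contMDiffAt hU hx)
    (hY.contMDiffAt hU hx) (by simp)).contMDiffWithinAt

theorem SmoothOn.dirDeriv (hU : IsOpen U) (hX : SmoothOn X U)
    (hf : ContMDiffOn (𝓡 m) 𝓘(ℝ) ∞ f U) : ContMDiffOn (𝓡 m) 𝓘(ℝ) ∞ (dirDeriv X f) U := by
  have h1 : ContMDiffOn (𝓡 m) 𝓘(ℝ).tangent ∞
      ((tangentMapWithin (𝓡 m) 𝓘(ℝ) f U) ∘ fun y ↦ (⟨y, X y⟩ : TangentBundle (𝓡 m) M)) U :=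
    (hf.contMDiffOn_tangentMapWithin (m := ∞) (by simp) hU.uniqueMDiffOn).comp hX
      fun y hy ↦ hy
  have h2 := (contMDiff_snd_tangentBundle_modelSpace (n := ∞) ℝ 𝓘(ℝ)).comp_contMDiffOn h1
  refine h2.congr fun y hy ↦ ?_
  simp only [RiemFol.dirDeriv, Function.comp, tangentMapWithin]
  rw [mfderivWithin_of_isOpen hU hy]
  rfl

theorem bracket_congr {X' Y' : VField m M} (hX : ∀ᶠ y in 𝓝 x, X y = X' y)
    (hY : ∀ᶠ y in 𝓝 x, Y y = Y' y) : bracket X Y x = bracket X' Y' x :=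
  Filter.EventuallyEq.mlieBracket_vectorField_eq hX hY

theorem bracket_smul_right (hf : MDifferentiableAt (𝓡 m) 𝓘(ℝ) f x) (hY : DiffAt Y x) :
    bracket X (f • Y) x = dirDeriv X f x • Y x + f x • bracket X Y x :=
  VectorField.mlieBracket_smul_right hf hY

theorem bracket_smul_left (hf : MDifferentiableAt (𝓡 m) 𝓘(ℝ) f x) (hX : DiffAt X x) :
    bracket (f • X) Y x = -dirDeriv Y f x • X x + f x • bracket X Y x :=
  VectorField.mlieBracket_smul_left hf hX

theorem bracket_swap : bracket X Y x = -bracket Y X x :=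
  VectorField.mlieBracket_swap_apply

theorem SmoothOn.extend_exists (v : TangentSpace (𝓡 m) x) :
    ∃ V : Set M, IsOpen V ∧ x ∈ V ∧
      SmoothOn (FiberBundle.extend (EuclideanSpace ℝ (Fin m)) v : VField m M) V := by
  obtain ⟨s, hs, h⟩ := FiberBundle.exists_contMDiffOn_extend (k := ∞) (𝓡 m) (EuclideanSpace ℝ (Fin m)) v
  obtain ⟨V, hVs, hV, hxV⟩ := mem_nhds_iff.1 hs
  exact ⟨V, hV, hxV, ContMDiffOn.mono h hVs⟩

/-- If two fields annihilate a function near a point, so does their bracket. The identity is the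
Jacobi identity for `X`, `Y` and `f Z`, where `Z` is nonzero at the point. -/
theorem dirDeriv_bracket_eq_zero (hU : IsOpen U) (hX : SmoothOn X U) (hY : SmoothOn Y U)
    (hf : ContMDiffOn (𝓡 m) 𝓘(ℝ) ∞ f U) (hXf : ∀ y ∈ U, dirDeriv X f y = 0)
    (hYf : ∀ y ∈ U, dirDeriv Y f y = 0) (hx : x ∈ U) : dirDeriv (RiemFol.bracket X Y) f x = 0 := by
  by_cases h0 : bracket X Y x = 0
  · simp only [RiemFol.dirDeriv]
    rw [h0, map_zero]
  obtain ⟨V, hV, hxV, hZV⟩ := SmoothOn.extend_exists (bracket X Y x)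
  set Z : VField m M := FiberBundle.extend (EuclideanSpace ℝ (Fin m)) (bracket X Y x) with hZ
  have hZx : Z x = bracket X Y x := FiberBundle.extend_apply_self _ _
  have hUV := hU.inter hV
  have hxUV : x ∈ U ∩ V := ⟨hx, hxV⟩
  have hX' : SmoothOn X (U ∩ V) := ContMDiffOn.mono hX Set.inter_subset_left
  have hY' : SmoothOn Y (U ∩ V) := ContMDiffOn.mono hY Set.inter_subset_left
  have hZ' : SmoothOn Z (U ∩ V) := ContMDiffOn.mono hZV Set.inter_subset_right
  have hf' : ContMDiffOn (𝓡 m) 𝓘(ℝ) ∞ f (U ∩ V) := hf.mono Set.inter_subset_left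
  have hfd : ∀ y ∈ U ∩ V, MDifferentiableAt (𝓡 m) 𝓘(ℝ) f y := fun y hy ↦
    (hf'.contMDiffAt (hUV.mem_nhds hy)).mdifferentiableAt (by simp)
  have sm : ∀ {W : VField m M}, SmoothOn W (U ∩ V) → (∀ y ∈ U ∩ V, dirDeriv W f y = 0) →
      ∀ {T : VField m M}, SmoothOn T (U ∩ V) → ∀ y ∈ U ∩ V,
        bracket W (f • T) y = (f • bracket W T) y := by
    intro W _ hWf T hT y hy
    rw [bracket_smul_right (hfd y hy) (hT.diffAt hUV hy), hWf y hy, zero_smul, zero_add]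
    rfl
  have iter : ∀ {W W' : VField m M}, SmoothOn W (U ∩ V) → (∀ y ∈ U ∩ V, dirDeriv W f y = 0) →
      SmoothOn W' (U ∩ V) → (∀ y ∈ U ∩ V, dirDeriv W' f y = 0) →
      bracket W (bracket W' (f • Z)) x = f x • bracket W (bracket W' Z) x := by
    intro W W' hW hWf hW' hWf'
    rw [bracket_congr (X' := W) (Y' := f • bracket W' Z) (by simp)
      (Filter.mem_of_superset (hUV.mem_nhds hxUV) (sm hW' hWf' hZ'))]
    exact sm hW hWf (hW'.bracket hUV hZ') x hxUV
  have jac : ∀ T : VField m M, SmoothOn T (U ∩ V) → bracket X (bracket Y T) x =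
      bracket (bracket X Y) T x + bracket Y (bracket X T) x := by
    intro T hT
    have h3 : ∀ {W : VField m M}, SmoothOn W (U ∩ V) → ContMDiffAt (𝓡 m) (𝓡 m).tangent
        (minSmoothness ℝ 2) (fun y ↦ (⟨y, W y⟩ : TangentBundle (𝓡 m) M)) x := fun hW ↦
      (hW.contMDiffAt hUV hxUV).of_le (by simpa using ENat.LEInfty.out)
    have : IsManifold (𝓡 m) (minSmoothness ℝ 3) M := by
      simp only [minSmoothness_of_isRCLikeNormedField]; infer_instance
    exact VectorField.leibniz_identity_mlieBracket_apply (h3 hX') (h3 hY') (h3 hT)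
  have hXf' : ∀ y ∈ U ∩ V, dirDeriv X f y = 0 := fun y hy ↦ hXf y hy.1
  have hYf' : ∀ y ∈ U ∩ V, dirDeriv Y f y = 0 := fun y hy ↦ hYf y hy.1
  have j1 := jac (f • Z) (hZ'.smul hf')
  rw [iter hX' hXf' hY' hYf', iter hY' hYf' hX' hXf', jac Z hZ',
    bracket_smul_right (hfd x hxUV) (hZ'.diffAt hUV hxUV), smul_add, hZx] at j1
  have j2 : dirDeriv (RiemFol.bracket X Y) f x • bracket X Y x = 0 := by
    have := sub_eq_zero.2 j1
    rw [← neg_eq_zero, ← this]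
    abel
  exact (smul_eq_zero.1 j2).resolve_right h0

end Calculus

section LeviCivita

variable [RiemannianBundle (fun x : M ↦ TangentSpace (𝓡 m) x)] [IsManifold (𝓡 m) ∞ M]
  [IsContMDiffRiemannianBundle (𝓡 m) ∞ (EuclideanSpace ℝ (Fin m))
    (fun x : M ↦ TangentSpace (𝓡 m) x)]
  {X Y Z : VField m M} {f g : M → ℝ} {x : M} {U : Set M}

/-! ### The Levi-Civita connection -/

theorem ip_comm (X Y : VField m M) : ip X Y = ip Y X := by
  ext x; exact real_inner_comm _ _

theorem mdifferentiableAt_ip (hX : DiffAt X x) (hY : DiffAt Y x) :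
    MDifferentiableAt (𝓡 m) 𝓘(ℝ) (ip X Y) x :=
  have : IsContMDiffRiemannianBundle (𝓡 m) 1 (EuclideanSpace ℝ (Fin m))
    (fun x : M ↦ TangentSpace (𝓡 m) x) := .of_le (n := ∞) ENat.LEInfty.out
  MDifferentiableAt.inner_bundle hX hY

theorem SmoothOn.ip (hX : SmoothOn X U) (hY : SmoothOn Y U) :
    ContMDiffOn (𝓡 m) 𝓘(ℝ) ∞ (ip X Y) U :=
  ContMDiffOn.inner_bundle hX hY

theorem ip_smul_left (X Y : VField m M) (f : M → ℝ) : ip (f • X) Y = f * ip X Y := by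
  ext y; simp [ip, inner_smul_left]

theorem ip_smul_right (X Y : VField m M) (f : M → ℝ) : ip X (f • Y) = f * ip X Y := by
  ext y; simp [ip, inner_smul_right]

theorem ip_add_left (X X' Y : VField m M) : ip (X + X') Y = ip X Y + ip X' Y := by
  ext y; simp [ip, inner_add_left]

theorem ip_add_right (X Y Y' : VField m M) : ip X (Y + Y') = ip X Y + ip X Y' := by
  ext y; simp [ip, inner_add_right]

theorem koszul_tensorial_right (hX : DiffAt X x) (hY : DiffAt Y x) :
    TensorialAt (𝓡 m) (EuclideanSpace ℝ (Fin m)) (fun Z : VField m M ↦ koszul X Y Z x) x where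
  smul {f Z} hf hZ := by
    have e1 : dirDeriv (f • Z) (ip X Y) x = f x * dirDeriv Z (ip X Y) x := by
      simp [dirDeriv]
    have e2 : ∀ W W' : VField m M, ip W W' x = inner ℝ (W x) (W' x) := fun _ _ ↦ rfl
    simp only [koszul]
    rw [ip_smul_right, ip_smul_left, ip_smul_right,
      dirDeriv_mul hf (mdifferentiableAt_ip hY hZ), dirDeriv_mul hf (mdifferentiableAt_ip hZ hX),
      e1, e2 (bracket X (f • Z)), e2 (bracket Y (f • Z)), bracket_smul_right hf hZ,
      bracket_smul_right hf hZ]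
    simp only [inner_add_left, inner_smul_left, ip, Pi.mul_apply, smul_eq_mul, conj_trivial]
    rw [real_inner_comm (Y x) (Z x)]
    ring
  add {Z Z'} hZ hZ' := by
    have e1 : dirDeriv (Z + Z') (ip X Y) x = dirDeriv Z (ip X Y) x + dirDeriv Z' (ip X Y) x := by
      simp [dirDeriv]
    have e2 : ∀ W W' : VField m M, ip W W' x = inner ℝ (W x) (W' x) := fun _ _ ↦ rfl
    have e3 : ∀ W : VField m M, bracket W (Z + Z') x = bracket W Z x + bracket W Z' x :=
      fun W ↦ VectorField.mlieBracket_add_right hZ hZ'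
    simp only [koszul]
    rw [ip_add_right, ip_add_left, ip_add_right,
      dirDeriv_add (mdifferentiableAt_ip hY hZ) (mdifferentiableAt_ip hY hZ'),
      dirDeriv_add (mdifferentiableAt_ip hZ hX) (mdifferentiableAt_ip hZ' hX),
      e1, e2 (bracket X (Z + Z')), e2 (bracket Y (Z + Z')), e3, e3]
    simp only [inner_add_left, ip, Pi.add_apply]
    ring

theorem koszul_tensorial_left (hY : DiffAt Y x) (hZ : DiffAt Z x) :
    TensorialAt (𝓡 m) (EuclideanSpace ℝ (Fin m)) (fun X : VField m M ↦ koszul X Y Z x) x where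
  smul {f X} hf hX := by
    have e1 : dirDeriv (f • X) (ip Y Z) x = f x * dirDeriv X (ip Y Z) x := by
      simp [dirDeriv]
    have e2 : ∀ W W' : VField m M, ip W W' x = inner ℝ (W x) (W' x) := fun _ _ ↦ rfl
    simp only [koszul]
    rw [ip_smul_right, ip_smul_left, ip_smul_right,
      dirDeriv_mul hf (mdifferentiableAt_ip hZ hX), dirDeriv_mul hf (mdifferentiableAt_ip hX hY),
      e1, e2 (bracket (f • X) Y), e2 (bracket (f • X) Z), bracket_smul_left hf hX,
      bracket_smul_left hf hX]
    simp only [inner_add_left, inner_smul_left, ip, Pi.mul_apply, smul_eq_mul, conj_trivial]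
    rw [real_inner_comm (X x) (Z x)]
    ring
  add {X X'} hX hX' := by
    have e1 : dirDeriv (X + X') (ip Y Z) x = dirDeriv X (ip Y Z) x + dirDeriv X' (ip Y Z) x := by
      simp [dirDeriv]
    have e2 : ∀ W W' : VField m M, ip W W' x = inner ℝ (W x) (W' x) := fun _ _ ↦ rfl
    have e3 : ∀ W : VField m M, bracket (X + X') W x = bracket X W x + bracket X' W x :=
      fun W ↦ VectorField.mlieBracket_add_left hX hX'
    simp only [koszul]
    rw [ip_add_right, ip_add_left, ip_add_right,
      dirDeriv_add (mdifferentiableAt_ip hZ hX) (mdifferentiableAt_ip hZ hX'),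
      dirDeriv_add (mdifferentiableAt_ip hX hY) (mdifferentiableAt_ip hX' hY),
      e1, e2 (bracket (X + X') Y), e2 (bracket (X + X') Z), e3, e3]
    simp only [inner_add_left, ip, Pi.add_apply]
    ring

/-- The Koszul formula: the tensoriality in the last argument removes the extensions in the
definition of `nabla`. -/
theorem ip_nabla (hX : DiffAt X x) (hY : DiffAt Y x) (hZ : DiffAt Z x) :
    ip (nabla X Y) Z x = 1 / 2 * koszul X Y Z x := by
  have T := koszul_tensorial_right hX hY
  have hlin : ∀ v : TangentSpace (𝓡 m) x,
      TensorialAt.mkHom (fun Z : VField m M ↦ koszul X Y Z x) x T v =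
        koszul X Y (FiberBundle.extend (EuclideanSpace ℝ (Fin m)) v) x := fun v ↦ rfl
  rw [← TensorialAt.mkHom_apply T hZ]
  set L := TensorialAt.mkHom (fun Z : VField m M ↦ koszul X Y Z x) x T
  set b := stdOrthonormalBasis ℝ (TangentSpace (𝓡 m) x)
  have h1 : ip (nabla X Y) Z x = ∑ k, (1 / 2 * L (b k)) * inner ℝ (b k) (Z x) := by
    simp only [ip, nabla, sum_inner, inner_smul_left, conj_trivial]
    rfl
  have h2 : L (Z x) = ∑ k, inner ℝ (b k) (Z x) * L (b k) := by
    conv_lhs => rw [← b.sum_repr' (Z x)]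
    rw [map_sum]
    exact Finset.sum_congr rfl fun k _ ↦ by rw [map_smul, smul_eq_mul]
  rw [h1, h2, Finset.mul_sum]
  exact Finset.sum_congr rfl fun k _ ↦ by ring

/-- A tangent vector is determined by its inner products with differentiable fields. -/
theorem eq_of_ip_eq (h : ∀ Z : VField m M, DiffAt Z x → ip X Z x = ip Y Z x) : X x = Y x := by
  refine ext_inner_right ℝ fun v ↦ ?_
  have := h (FiberBundle.extend (EuclideanSpace ℝ (Fin m)) v)
    (FiberBundle.mdifferentiableAt_extend (𝓡 m) (EuclideanSpace ℝ (Fin m)) v)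
  simpa [ip] using this

/-- `∇` is compatible with the metric. -/
theorem dirDeriv_ip (hX : DiffAt X x) (hY : DiffAt Y x) (hZ : DiffAt Z x) :
    dirDeriv Z (ip X Y) x = ip (nabla Z X) Y x + ip X (nabla Z Y) x := by
  rw [ip_comm X (nabla Z Y), ip_nabla hZ hX hY, ip_nabla hZ hY hX]
  have h : ip (bracket X Y) Z x = -ip (bracket Y X) Z x := by
    simp only [ip]; rw [bracket_swap, inner_neg_left]
  simp only [koszul]
  rw [h, ip_comm Y X, ip_comm Z X, ip_comm Y Z]
  ring

/-- `∇` is torsion-free. -/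
theorem bracket_eq_nabla_sub (hX : DiffAt X x) (hY : DiffAt Y x) :
    bracket X Y x = nabla X Y x - nabla Y X x := by
  refine eq_of_ip_eq (Y := nabla X Y - nabla Y X) fun Z hZ ↦ ?_
  have h1 : ip (nabla X Y - nabla Y X) Z x = ip (nabla X Y) Z x - ip (nabla Y X) Z x := by
    simp [ip, inner_sub_left]
  have h : ip (bracket Y X) Z x = -ip (bracket X Y) Z x := by
    simp only [ip]; rw [bracket_swap, inner_neg_left]
  rw [h1, ip_nabla hX hY hZ, ip_nabla hY hX hZ]
  simp only [koszul]
  rw [h, ip_comm Y X, ip_comm Z X, ip_comm Y Z]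
  ring

theorem ip_bracket (hX : DiffAt X x) (hY : DiffAt Y x) :
    ip (bracket X Y) Z x = ip (nabla X Y) Z x - ip (nabla Y X) Z x := by
  simp only [ip]
  rw [bracket_eq_nabla_sub hX hY, inner_sub_left]

/-- `∇_X Y` is linear in the value of `X` at the point. -/
theorem ip_nabla_of_eq_sum {ι : Type*} (s : Finset ι) (c : ι → ℝ) {E : ι → VField m M}
    (hX : DiffAt X x) (hE : ∀ i, DiffAt (E i) x) (hY : DiffAt Y x) (hZ : DiffAt Z x)
    (h : X x = ∑ i ∈ s, c i • E i x) :
    ip (nabla X Y) Z x = ∑ i ∈ s, c i * ip (nabla (E i) Y) Z x := by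
  have T := koszul_tensorial_left hY hZ
  have hc : ∀ i, MDifferentiableAt (𝓡 m) 𝓘(ℝ) (fun _ : M ↦ c i) x :=
    fun i ↦ mdifferentiableAt_const
  have hcE : ∀ i, DiffAt ((fun _ : M ↦ c i) • E i) x := fun i ↦ (hc i).smul_section (hE i)
  have hsum : DiffAt (fun y ↦ ∑ i ∈ s, ((fun _ : M ↦ c i) • E i) y) x :=
    .sum_section fun i _ ↦ hcE i
  rw [ip_nabla hX hY hZ, T.pointwise hX hsum h, T.sum _ fun i _ ↦ hcE i, Finset.mul_sum]
  refine Finset.sum_congr rfl fun i _ ↦ ?_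
  rw [T.smul (hc i) (hE i), ip_nabla (hE i) hY hZ, smul_eq_mul]
  ring

/-- `∇_X Y` depends only on the germs of `X` and `Y`. -/
theorem nabla_congr {X' Y' : VField m M} (hX : ∀ᶠ y in 𝓝 x, X y = X' y)
    (hY : ∀ᶠ y in 𝓝 x, Y y = Y' y) : nabla X Y x = nabla X' Y' x := by
  have key : ∀ Z : VField m M, koszul X Y Z x = koszul X' Y' Z x := by
    intro Z
    have h1 : dirDeriv X (ip Y Z) x = dirDeriv X' (ip Y' Z) x := by
      rw [dirDeriv_congr (g := ip Y' Z) (hY.mono fun y hy ↦ by simp only [ip]; rw [hy])]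
      simp only [dirDeriv]; rw [hX.self_of_nhds]
    have h2 : dirDeriv Y (ip Z X) x = dirDeriv Y' (ip Z X') x := by
      rw [dirDeriv_congr (g := ip Z X') (hX.mono fun y hy ↦ by simp only [ip]; rw [hy])]
      simp only [dirDeriv]; rw [hY.self_of_nhds]
    have h3 : dirDeriv Z (ip X Y) x = dirDeriv Z (ip X' Y') x :=
      dirDeriv_congr ((hX.and hY).mono fun y hy ↦ by simp only [ip]; rw [hy.1, hy.2])
    simp only [koszul]
    rw [h1, h2, h3]
    simp only [ip]
    rw [bracket_congr hX hY, bracket_congr hX (.of_forall fun _ ↦ rfl),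
      bracket_congr hY (.of_forall fun _ ↦ rfl), hX.self_of_nhds, hY.self_of_nhds]
  simp only [nabla, key]

theorem nabla_neg_neg (hX : DiffAt X x) : nabla (-X) (-X) x = nabla X X x := by
  have e : (-X : VField m M) = (fun _ : M ↦ (-1 : ℝ)) • X := by
    funext y; simp
  have hn : DiffAt (-X) x := by
    rw [e]
    exact (mdifferentiableAt_const (c := (-1 : ℝ))).smul_section hX
  refine eq_of_ip_eq fun Z hZ ↦ ?_
  have h1 : ip X (-X) = -ip X X := by ext y; simp [ip]
  have h2 : ip (-X) Z = -ip X Z := by ext y; simp [ip]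
  have h3 : ip Z (-X) = -ip Z X := by ext y; simp [ip]
  have h4 : ip (-X) (-X) = ip X X := by ext y; simp [ip]
  have hb : bracket (-X) Z x = -bracket X Z x := by
    rw [e, bracket_smul_left mdifferentiableAt_const hX]
    simp [dirDeriv, mvfderiv_const]
  have hd : ∀ f : M → ℝ, dirDeriv (-X) f x = -dirDeriv X f x := by
    intro f; simp [dirDeriv]
  have hbb : bracket (-X) (-X) x = bracket X X x := by simp [bracket]
  rw [ip_nabla hn hn hZ, ip_nabla hX hX hZ]
  simp only [koszul]
  rw [h2, h3, h4, dirDeriv_neg, dirDeriv_neg, hd, hd]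
  simp only [ip]
  rw [hb, hbb]
  simp

theorem koszul_contMDiffOn (hU : IsOpen U) (hX : SmoothOn X U) (hY : SmoothOn Y U)
    (hZ : SmoothOn Z U) : ContMDiffOn (𝓡 m) 𝓘(ℝ) ∞ (koszul X Y Z) U :=
  (((((hX.dirDeriv hU (hY.ip hZ)).add (hY.dirDeriv hU (hZ.ip hX))).sub
    (hZ.dirDeriv hU (hX.ip hY))).add ((hX.bracket hU hY).ip hZ)).sub
    ((hX.bracket hU hZ).ip hY)).sub ((hY.bracket hU hZ).ip hX)

/-! ### Orthonormal frames -/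

/-- `E` is a smooth orthonormal frame on the open set `U`. -/
structure IsFrame (U : Set M) (E : Fin m → VField m M) : Prop where
  isOpen : IsOpen U
  smooth : ∀ a, SmoothOn (E a) U
  inner_eq : ∀ a b, ∀ x ∈ U, ip (E a) (E b) x = if a = b then 1 else 0

variable {E : Fin m → VField m M}

/-- The basis of the tangent space given by an orthonormal frame. -/
def IsFrame.basis (hE : IsFrame U E) (hx : x ∈ U) :
    OrthonormalBasis (Fin m) ℝ (TangentSpace (𝓡 m) x) :=
  OrthonormalBasis.mk (v := fun a ↦ E a x)
    (orthonormal_iff_ite.2 fun a b ↦ hE.inner_eq a b x hx) <| by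
      have h : Orthonormal ℝ fun a ↦ E a x :=
        orthonormal_iff_ite.2 fun a b ↦ hE.inner_eq a b x hx
      have hc : Fintype.card (Fin m) = Module.finrank ℝ (TangentSpace (𝓡 m) x) := by
        rw [Fintype.card_fin]
        exact (finrank_euclideanSpace_fin (𝕜 := ℝ) (n := m)).symm
      exact (h.linearIndependent.span_eq_top_of_card_eq_finrank' hc).ge

theorem IsFrame.basis_apply (hE : IsFrame U E) (hx : x ∈ U) (a : Fin m) :
    hE.basis hx a = E a x := by
  simp [IsFrame.basis]

theorem IsFrame.eq_sum (hE : IsFrame U E) (hx : x ∈ U) (X : VField m M) :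
    X x = ∑ a, ip X (E a) x • E a x := by
  conv_lhs => rw [← (hE.basis hx).sum_repr' (X x)]
  refine Finset.sum_congr rfl fun a _ ↦ ?_
  rw [hE.basis_apply hx, real_inner_comm]
  rfl

theorem IsFrame.ip_eq_sum (hE : IsFrame U E) (hx : x ∈ U) (X Y : VField m M) :
    ip X Y x = ∑ a, ip X (E a) x * ip Y (E a) x := by
  simp only [ip]
  rw [hE.eq_sum hx X, sum_inner]
  refine Finset.sum_congr rfl fun a _ ↦ ?_
  rw [inner_smul_left, ← hE.eq_sum hx X, real_inner_comm (E a x) (Y x)]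
  rfl

theorem SmoothOn.nabla (hE : IsFrame U E) (hX : SmoothOn X U) (hY : SmoothOn Y U) :
    SmoothOn (nabla X Y) U := by
  refine (SmoothOn.sum Finset.univ fun a ↦ SmoothOn.smul
    (f := fun x ↦ 1 / 2 * koszul X Y (E a) x)
    (contMDiffOn_const.mul (koszul_contMDiffOn hE.isOpen hX hY (hE.smooth a)))
    (hE.smooth a)).congr fun x hx ↦ ?_
  rw [hE.eq_sum hx (RiemFol.nabla X Y)]
  refine Finset.sum_congr rfl fun a _ ↦ ?_
  rw [ip_nabla (hX.diffAt hE.isOpen hx) (hY.diffAt hE.isOpen hx)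
    ((hE.smooth a).diffAt hE.isOpen hx)]
  rfl

end LeviCivita

end LocalGeometry

/-! ### Integrability of the two foliations -/

section Involutive

variable {m k q : ℕ} {M : Type*} [TopologicalSpace M] [ChartedSpace (EuclideanSpace ℝ (Fin m)) M]
  [IsManifold (𝓡 m) ∞ M]

/-- The fields tangent to a foliation are closed under the Lie bracket: they annihilate the
transverse coordinates of the foliated charts. -/
theorem Foliation.isTangent_bracket (F : Foliation m k q M) {X Y : VField m M} {U : Set M}
    (hU : IsOpen U) (hX : SmoothOn X U) (hY : SmoothOn Y U)
    (hXF : ∀ x ∈ U, F.IsTangent (X x)) (hYF : ∀ x ∈ U, F.IsTangent (Y x)) {x : M} (hx : x ∈ U) :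
    F.IsTangent (bracket X Y x) := by
  intro φ hφ hxφ
  set g : M → EuclideanSpace ℝ (Fin q) := fun y ↦ (φ y).2 with hg
  have hgs : ContMDiffOn (𝓡 m) (𝓡 q) ∞ g φ.source :=
    (ContinuousLinearMap.snd ℝ (EuclideanSpace ℝ (Fin k))
      (EuclideanSpace ℝ (Fin q))).contMDiff.comp_contMDiffOn (F.smooth φ hφ)
  have hgd : ∀ y ∈ φ.source, MDifferentiableAt (𝓡 m) (𝓡 q) g y := fun y hy ↦
    (hgs.contMDiffAt (φ.open_source.mem_nhds hy)).mdifferentiableAt (by simp)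
  -- The coordinates of the derivative of `g` are the derivatives of the coordinates of `g`.
  have hcomp : ∀ (j : Fin q) (W : VField m M), ∀ y ∈ φ.source,
      dirDeriv W (fun z ↦ g z j) y =
        (EuclideanSpace.proj j : EuclideanSpace ℝ (Fin q) →L[ℝ] ℝ)
          (mfderiv (𝓡 m) (𝓡 q) g y (W y)) := by
    intro j W y hy
    have hL := (EuclideanSpace.proj j : EuclideanSpace ℝ (Fin q) →L[ℝ] ℝ).hasMFDerivAt (x := g y)
    have := (hL.comp y (hgd y hy).hasMFDerivAt).mfderiv
    simp only [dirDeriv, mvfderiv]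
    change (mfderiv (𝓡 m) 𝓘(ℝ, ℝ)
      ((EuclideanSpace.proj j : EuclideanSpace ℝ (Fin q) →L[ℝ] ℝ) ∘ g) y) (W y) = _
    rw [this]
    rfl
  have hUφ := hU.inter φ.open_source
  have key : ∀ j : Fin q, dirDeriv (bracket X Y) (fun z ↦ g z j) x = 0 := by
    intro j
    refine dirDeriv_bracket_eq_zero hUφ (ContMDiffOn.mono hX Set.inter_subset_left)
      (ContMDiffOn.mono hY Set.inter_subset_left) ?_ ?_ ?_ ⟨hx, hxφ⟩
    · exact (EuclideanSpace.proj j :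
        EuclideanSpace ℝ (Fin q) →L[ℝ] ℝ).contMDiff.comp_contMDiffOn (hgs.mono Set.inter_subset_right)
    · intro y hy
      rw [hcomp j X y hy.2, hXF y hy.1 φ hφ hy.2]
      rfl
    · intro y hy
      rw [hcomp j Y y hy.2, hYF y hy.1 φ hφ hy.2]
      rfl
  refine PiLp.ext fun j ↦ ?_
  have := key j
  rw [hcomp j _ x hxφ] at this
  exact this

end Involutive

section Identity

variable {n p : ℕ} {M : Type*} [TopologicalSpace M]
  [ChartedSpace (EuclideanSpace ℝ (Fin (n + p))) M]
  [RiemannianBundle (fun x : M ↦ TangentSpace (𝓡 (n + p)) x)] [IsManifold (𝓡 (n + p)) ∞ M]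
  [IsContMDiffRiemannianBundle (𝓡 (n + p)) ∞ (EuclideanSpace ℝ (Fin (n + p)))
    (fun x : M ↦ TangentSpace (𝓡 (n + p)) x)]
  {F : Foliation (n + p) n p M} {G : Foliation (n + p) p n M} {U : Set M}
  {e : Fin n → VField (n + p) M} {u : Fin p → VField (n + p) M}

/-! ### The integrand as a divergence -/

theorem IsAdaptedFrame.isFrame (h : IsAdaptedFrame F G U e u) : IsFrame U (Fin.append e u) where
  isOpen := h.isOpen
  smooth a := by
    refine Fin.addCases (fun i ↦ ?_) (fun β ↦ ?_) a
    · rw [Fin.append_left]; exact h.smooth_e i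
    · rw [Fin.append_right]; exact h.smooth_u β
  inner_eq a b x hx := by
    refine Fin.addCases (fun i ↦ ?_) (fun β ↦ ?_) a <;>
      refine Fin.addCases (fun j ↦ ?_) (fun γ ↦ ?_) b
    · simp [h.inner_e i j x hx]
    · have : (Fin.castAdd p i) ≠ Fin.natAdd n γ := by
        intro h; have := congrArg Fin.val h; simp at this; omega
      simp [h.inner_e_u i γ x hx, this]
    · have : Fin.natAdd n β ≠ Fin.castAdd p j := by
        intro h; have := congrArg Fin.val h; simp at this; omega
      simp [ip_comm (u β) (e j), h.inner_e_u j β x hx, this]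
    · simp [h.inner_u β γ x hx]

theorem ip_nabla_add_eq_zero {P Q Z : VField (n + p) M} {x : M} {c : ℝ} (hU : IsOpen U)
    (hx : x ∈ U) (hP : DiffAt P x) (hQ : DiffAt Q x) (hZ : DiffAt Z x)
    (h : ∀ y ∈ U, ip P Q y = c) : ip (nabla Z P) Q x + ip P (nabla Z Q) x = 0 := by
  rw [← dirDeriv_ip hP hQ hZ]
  exact dirDeriv_eq_zero_of_eventually_const (Filter.mem_of_superset (hU.mem_nhds hx) h)

theorem IsAdaptedFrame.ip_perp (h : IsAdaptedFrame F G U e u) (X : VField (n + p) M) (α : Fin p)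
    {x : M} (hx : x ∈ U) : ip (perp u X) (u α) x = ip X (u α) x := by
  have h1 : ∀ β, inner ℝ (u β x) (u α x) = if β = α then (1 : ℝ) else 0 :=
    fun β ↦ h.inner_u β α x hx
  simp [ip, perp, sum_inner, inner_smul_left, h1]

/-- The pointwise identity behind the integral formula: by the symmetry of the second fundamental
forms of the two foliations, the integrand is `-div (∇_{e_α} e_α)`. -/
theorem IsAdaptedFrame.integrand_eq (h : IsAdaptedFrame F G U e u) (hFG : F.Orthogonal G)
    (α : Fin p) {x : M} (hx : x ∈ U) :
    integrand e u α x = -divAlong (Fin.append e u) (nabla (u α) (u α)) x := by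
  have hE := h.isFrame
  have hU := h.isOpen
  have se := h.smooth_e
  have su := h.smooth_u
  have de : ∀ i, DiffAt (e i) x := fun i ↦ (se i).diffAt hU hx
  have du : ∀ β, DiffAt (u β) x := fun β ↦ (su β).diffAt hU hx
  set ν := u α with hν
  have sν : SmoothOn ν U := su α
  have dν : DiffAt ν x := du α
  have dN : ∀ {X Y : VField (n + p) M}, SmoothOn X U → SmoothOn Y U → DiffAt (nabla X Y) x :=
    fun hX hY ↦ (SmoothOn.nabla hE hX hY).diffAt hU hx
  -- The coefficients of the derivatives of the frame.
  set A : Fin n → Fin n → ℝ := fun i j ↦ ip (nabla ν (e i)) (e j) x with hA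
  set H : Fin n → Fin n → ℝ := fun i j ↦ secondForm ν (e i) (e j) x with hH
  set b : Fin n → Fin p → ℝ := fun i β ↦ ip (nabla ν (e i)) (u β) x with hb
  set d : Fin n → Fin p → ℝ := fun i β ↦ ip (nabla (e i) ν) (u β) x with hd
  have heu : ∀ i β, ∀ y ∈ U, ip (e i) (u β) y = 0 := h.inner_e_u
  have hH' : ∀ i j, ip (nabla (e i) ν) (e j) x = -H i j := by
    intro i j; simp [hH, secondForm, ip]
  have hHn : ∀ i j, ip (nabla (e j) (e i)) ν x = H j i := by
    intro i j
    have := ip_nabla_add_eq_zero hU hx (de i) dν (de j) (heu i α)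
    rw [ip_comm (e i), hH'] at this
    linarith
  have Asymm : ∀ i j, A i j = -A j i := by
    intro i j
    have := ip_nabla_add_eq_zero hU hx (de i) (de j) dν (h.inner_e i j)
    rw [ip_comm (e i)] at this
    simp only [hA]
    linarith
  have Hsymm : ∀ i j, H i j = H j i := by
    intro i j
    have h0 : ip (bracket (e i) (e j)) ν x = 0 :=
      hFG x _ _ (F.isTangent_bracket hU (se i) (se j) (h.tangent_e i) (h.tangent_e j) hx)
        (h.tangent_u α x hx)
    rw [ip_bracket (de i) (de j), hHn, hHn] at h0
    linarith
  have bsymm : ∀ i β, ip (nabla (u β) (e i)) ν x = b i β := by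
    intro i β
    have h0 : ip (bracket (u β) ν) (e i) x = 0 := by
      rw [ip_comm]
      exact hFG x _ _ (h.tangent_e i x hx)
        (G.isTangent_bracket hU (su β) sν (h.tangent_u β) (h.tangent_u α) hx)
    rw [ip_bracket (du β) dν] at h0
    have h1 := ip_nabla_add_eq_zero hU hx (de i) dν (du β) (heu i α)
    have h2 := ip_nabla_add_eq_zero hU hx (de i) (du β) dν (heu i β)
    rw [ip_comm (e i)] at h1 h2
    simp only [hb]
    linarith
  -- The derivative of the mean curvature.
  have t0 : dirDeriv ν (ip (meanCurv e u) ν) x =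
      ∑ i, dirDeriv ν (ip (nabla (e i) (e i)) ν) x := by
    rw [← dirDeriv_sum _ fun i _ ↦ mdifferentiableAt_ip (dN (se i) (se i)) dν]
    refine dirDeriv_congr (Filter.mem_of_superset (hU.mem_nhds hx) fun y hy ↦ ?_)
    change inner ℝ (∑ i, perp u (nabla (e i) (e i)) y) (ν y) = _
    rw [sum_inner]
    exact Finset.sum_congr rfl fun i _ ↦ h.ip_perp _ α hy
  have t1 : ∀ i, dirDeriv ν (ip (nabla (e i) (e i)) ν) x =
      ip (nabla ν (nabla (e i) (e i))) ν x + ip (nabla (e i) (e i)) (nabla ν ν) x :=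
    fun i ↦ dirDeriv_ip (dN (se i) (se i)) dν dν
  have t2 : ∀ i, curv ν (e i) (e i) ν x = ip (nabla ν (nabla (e i) (e i))) ν x
      - ip (nabla (e i) (nabla ν (e i))) ν x - ip (nabla (bracket ν (e i)) (e i)) ν x := by
    intro i
    simp [curv, ip, inner_sub_left]
  have t3 : ∀ i, ip (nabla (e i) (nabla ν (e i))) ν x + ip (nabla ν (e i)) (nabla (e i) ν) x
      + ip (nabla (e i) (e i)) (nabla ν ν) x + ip (e i) (nabla (e i) (nabla ν ν)) x = 0 := by
    intro i
    have dνe := dN sν (se i)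
    have dνν := dN sν sν
    have e1 := dirDeriv_ip dνe dν (de i)
    have e2 := dirDeriv_ip (de i) dνν (de i)
    have e3 := dirDeriv_add (X := e i) (mdifferentiableAt_ip dνe dν)
      (mdifferentiableAt_ip (de i) dνν)
    rw [dirDeriv_eq_zero_of_eventually_const (c := 0)] at e3
    · linarith
    · refine Filter.mem_of_superset (hU.mem_nhds hx) fun y hy ↦ ?_
      exact ip_nabla_add_eq_zero hU hy ((se i).diffAt hU hy) (sν.diffAt hU hy)
        (sν.diffAt hU hy) (heu i α)
  have t4 : ∀ i, ip (nabla ν (e i)) (nabla (e i) ν) x =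
      -(∑ j, A i j * H i j) + ∑ β, b i β * d i β := by
    intro i
    rw [hE.ip_eq_sum hx, Fin.sum_univ_add]
    simp only [Fin.append_left, Fin.append_right, hH', mul_neg, Finset.sum_neg_distrib]
    rfl
  have t5 : ∀ i, ip (nabla (bracket ν (e i)) (e i)) ν x =
      ∑ j, (A i j + H i j) * H i j + ∑ β, (b i β - d i β) * b i β := by
    intro i
    rw [ip_nabla_of_eq_sum Finset.univ (fun a ↦ ip (bracket ν (e i)) (Fin.append e u a) x)
      ((sν.bracket hU (se i)).diffAt hU hx) (fun a ↦ (hE.smooth a).diffAt hU hx) (de i) dν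
      (hE.eq_sum hx _), Fin.sum_univ_add]
    simp only [Fin.append_left, Fin.append_right]
    congr 1
    · refine Finset.sum_congr rfl fun j _ ↦ ?_
      rw [ip_bracket dν (de i), hH', hHn, Hsymm j i, sub_neg_eq_add]
    · refine Finset.sum_congr rfl fun β _ ↦ ?_
      rw [ip_bracket dν (de i), bsymm]
  have t6 : ∀ i, secondForm (e i) ν
      (fun y ↦ perp u (nabla (e i) ν) y - perp u (bracket ν (e i)) y) x =
        -∑ β, b i β * (2 * d i β - b i β) := by
    intro i
    have e1 : ∀ β, inner ℝ (nabla ν (e i) x) (u β x) = b i β := fun _ ↦ rfl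
    have e2 : ∀ β, ip (bracket ν (e i)) (u β) x = b i β - d i β :=
      fun β ↦ ip_bracket dν (de i)
    change inner ℝ (-nabla ν (e i) x) (∑ β, d i β • u β x
      - ∑ β, ip (bracket ν (e i)) (u β) x • u β x) = _
    simp only [inner_neg_left, inner_sub_right, inner_sum, inner_smul_right, e1, e2]
    rw [← Finset.sum_sub_distrib, ← Finset.sum_neg_distrib]
    exact Finset.sum_congr rfl fun β _ ↦ by ring
  have t7 : divAlong (Fin.append e u) (nabla ν ν) x =
      ∑ i, ip (e i) (nabla (e i) (nabla ν ν)) x + divAlong u (nabla ν ν) x := by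
    simp only [divAlong, Fin.sum_univ_add, Fin.append_left, Fin.append_right]
  have t8 : ∑ i, ∑ j, A i j * H i j = 0 := by
    have : ∑ i, ∑ j, A i j * H i j = -∑ i, ∑ j, A i j * H i j := by
      conv_lhs => rw [Finset.sum_comm]
      rw [← Finset.sum_neg_distrib]
      refine Finset.sum_congr rfl fun i _ ↦ ?_
      rw [← Finset.sum_neg_distrib]
      refine Finset.sum_congr rfl fun j _ ↦ ?_
      rw [Asymm j i, Hsymm j i]; ring
    linarith
  have per : ∀ i, dirDeriv ν (ip (nabla (e i) (e i)) ν) x - ∑ j, H i j ^ 2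
      - curv ν (e i) (e i) ν x - secondForm (e i) ν
        (fun y ↦ perp u (nabla (e i) ν) y - perp u (bracket ν (e i)) y) x
      + ip (e i) (nabla (e i) (nabla ν ν)) x = 2 * ∑ j, A i j * H i j := by
    intro i
    have q1 : ∑ j, (A i j + H i j) * H i j = ∑ j, A i j * H i j + ∑ j, H i j ^ 2 := by
      rw [← Finset.sum_add_distrib]
      exact Finset.sum_congr rfl fun j _ ↦ by ring
    have q2 : ∑ β, (b i β - d i β) * b i β + ∑ β, b i β * (2 * d i β - b i β)
        = ∑ β, b i β * d i β := by
      rw [← Finset.sum_add_distrib]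
      exact Finset.sum_congr rfl fun j _ ↦ by ring
    have := t3 i
    rw [t4] at this
    rw [t1, t2, t5, t6, q1]
    linarith
  have total := Finset.sum_congr (rfl : (Finset.univ : Finset (Fin n)) = Finset.univ)
    fun i _ ↦ per i
  simp only [Finset.sum_add_distrib, Finset.sum_sub_distrib, ← Finset.mul_sum] at total
  rw [t8] at total
  rw [t7]
  simp only [integrand, normSqSecondForm, traceK]
  rw [t0]
  linarith

/-- In an orthonormal frame, the divergence can be computed with Lie brackets alone. -/
theorem divAlong_eq_neg_sum_bracket {m : ℕ} {M : Type*} [TopologicalSpace M]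
    [ChartedSpace (EuclideanSpace ℝ (Fin m)) M]
    [RiemannianBundle (fun x : M ↦ TangentSpace (𝓡 m) x)] [IsManifold (𝓡 m) ∞ M]
    [IsContMDiffRiemannianBundle (𝓡 m) ∞ (EuclideanSpace ℝ (Fin m))
      (fun x : M ↦ TangentSpace (𝓡 m) x)] {U : Set M} {E : Fin m → VField m M}
    (hE : IsFrame U E) {X : VField m M} {x : M} (hx : x ∈ U) (hX : DiffAt X x) :
    divAlong E X x = -∑ a, ip (bracket X (E a)) (E a) x := by
  simp only [divAlong]
  rw [← Finset.sum_neg_distrib]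
  refine Finset.sum_congr rfl fun a _ ↦ ?_
  have da := (hE.smooth a).diffAt hE.isOpen hx
  have h0 : dirDeriv X (ip (E a) (E a)) x = 0 :=
    dirDeriv_eq_zero_of_eventually_const
      (Filter.mem_of_superset (hE.isOpen.mem_nhds hx) (hE.inner_eq a a))
  rw [dirDeriv_ip da da hX, ip_comm (E a) (nabla X (E a))] at h0
  rw [ip_bracket hX da, ip_comm (E a)]
  linarith

end Identity

/-! ### The derivative of a determinant -/

section Determinant

/-- Jacobi's formula: the derivative of `det B` is `det B · tr (B⁻¹ B')`. -/
theorem fderiv_det {ι V : Type*} [Fintype ι] [DecidableEq ι] [NormedAddCommGroup V]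
    [NormedSpace ℝ V] {B : V → ι → ι → ℝ} {v : V} (hB : DifferentiableAt ℝ B v)
    {C : Matrix ι ι ℝ} (hC : Matrix.of (B v) * C = 1) (w : V) :
    DifferentiableAt ℝ (fun v' ↦ (Matrix.of (B v')).det) v ∧
    fderiv ℝ (fun v' ↦ (Matrix.of (B v')).det) v w =
      (Matrix.of (B v)).det * ∑ a, ∑ i, fderiv ℝ B v w a i * C i a := by
  let D : ContinuousMultilinearMap ℝ (fun _ : ι ↦ ι → ℝ) ℝ :=
    { (Matrix.detRowAlternating (n := ι) (R := ℝ)).toMultilinearMap with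
      cont := continuous_id.matrix_det }
  have hD : ∀ A : ι → ι → ℝ, D A = (Matrix.of A).det := fun A ↦ rfl
  have h1 := (D.hasFDerivAt (B v)).comp v hB.hasFDerivAt
  refine ⟨h1.differentiableAt, ?_⟩
  have h2 : fderiv ℝ (fun v' ↦ (Matrix.of (B v')).det) v w =
      ∑ a, D (Function.update (B v) a (fderiv ℝ B v w a)) := by
    have : (fun v' ↦ (Matrix.of (B v')).det) = D ∘ B := rfl
    rw [this, h1.fderiv]
    simp [ContinuousMultilinearMap.linearDeriv_apply]
  rw [h2, Finset.mul_sum]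
  refine Finset.sum_congr rfl fun a _ ↦ ?_
  have hadj : (Matrix.of (B v)).adjugate = (Matrix.of (B v)).det • C := by
    calc (Matrix.of (B v)).adjugate = (Matrix.of (B v)).adjugate * (Matrix.of (B v) * C) := by
          rw [hC, mul_one]
      _ = _ := by rw [← mul_assoc, Matrix.adjugate_mul, Matrix.smul_mul, one_mul]
  have h3 : D (Function.update (B v) a (fderiv ℝ B v w a)) =
      Matrix.cramer (Matrix.of (B v)).transpose (fderiv ℝ B v w a) a := by
    rw [Matrix.cramer_transpose_apply]; rfl
  rw [h3, Matrix.cramer_eq_adjugate_mulVec, ← Matrix.adjugate_transpose, hadj, Finset.mul_sum]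
  simp only [Matrix.mulVec, dotProduct, Matrix.transpose_apply, Matrix.smul_apply, smul_eq_mul]
  exact Finset.sum_congr rfl fun i _ ↦ by ring

end Determinant

/-! ### Vector fields in the coordinates of a chart -/

section Coordinates

variable {m : ℕ} {M : Type*} [TopologicalSpace M] [ChartedSpace (EuclideanSpace ℝ (Fin m)) M]
  [IsManifold (𝓡 m) ∞ M]

/-- The coordinate expression of the vector field `X` in the preferred chart at `c`. -/
def coord (c : M) (X : VField m M) : EuclideanSpace ℝ (Fin m) → EuclideanSpace ℝ (Fin m) :=
  VectorField.mpullback (𝓡 m) (𝓡 m) (chartAt (EuclideanSpace ℝ (Fin m)) c).symm X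

variable {c : M} {X Y : VField m M} {v : EuclideanSpace ℝ (Fin m)}

theorem isInvertible_mfderiv_chart_symm (hv : v ∈ (chartAt (EuclideanSpace ℝ (Fin m)) c).target) :
    (mfderiv (𝓡 m) (𝓡 m) (chartAt (EuclideanSpace ℝ (Fin m)) c).symm v).IsInvertible :=
  ⟨((mdifferentiable_chart (I := 𝓡 m) c).symm).mfderiv hv, rfl⟩

theorem mfderiv_coord (hv : v ∈ (chartAt (EuclideanSpace ℝ (Fin m)) c).target) :
    mfderiv (𝓡 m) (𝓡 m) (chartAt (EuclideanSpace ℝ (Fin m)) c).symm v (coord c X v) =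
      X ((chartAt (EuclideanSpace ℝ (Fin m)) c).symm v) :=
  (isInvertible_mfderiv_chart_symm hv).self_apply_inverse _

theorem contMDiffAt_chart_symm (hv : v ∈ (chartAt (EuclideanSpace ℝ (Fin m)) c).target) :
    ContMDiffAt (𝓡 m) (𝓡 m) ∞ (chartAt (EuclideanSpace ℝ (Fin m)) c).symm v :=
  (contMDiffOn_chart_symm (I := 𝓡 m) (n := ∞) (x := c)).contMDiffAt
    ((chartAt (EuclideanSpace ℝ (Fin m)) c).open_target.mem_nhds hv)

theorem contDiffAt_coord (hv : v ∈ (chartAt (EuclideanSpace ℝ (Fin m)) c).target) {U : Set M}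
    (hU : IsOpen U) (hX : SmoothOn X U)
    (hvU : (chartAt (EuclideanSpace ℝ (Fin m)) c).symm v ∈ U) : ContDiffAt ℝ ∞ (coord c X) v :=
  contMDiffAt_vectorSpace_iff_contDiffAt.1 <|
    ContMDiffAt.mpullback_vectorField_preimage (n := ∞) (hX.contMDiffAt hU hvU)
      (contMDiffAt_chart_symm hv) (isInvertible_mfderiv_chart_symm hv) (by simp)

theorem coord_bracket (hv : v ∈ (chartAt (EuclideanSpace ℝ (Fin m)) c).target)
    (hX : DiffAt X ((chartAt (EuclideanSpace ℝ (Fin m)) c).symm v))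
    (hY : DiffAt Y ((chartAt (EuclideanSpace ℝ (Fin m)) c).symm v)) :
    coord c (bracket X Y) v = VectorField.lieBracket ℝ (coord c X) (coord c Y) v := by
  have : IsManifold (𝓡 m) (minSmoothness ℝ 2) M := by
    simp only [minSmoothness_of_isRCLikeNormedField]; infer_instance
  have : IsManifold (𝓡 m) (minSmoothness ℝ 3) M := by
    simp only [minSmoothness_of_isRCLikeNormedField]; infer_instance
  have h := VectorField.mpullback_mlieBracket (n := ∞) hX hY (contMDiffAt_chart_symm hv)
    (by simpa using ENat.LEInfty.out)
  refine h.trans ?_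
  rw [← VectorField.mlieBracketWithin_univ, VectorField.mlieBracketWithin_eq_lieBracketWithin]
  exact congrFun (VectorField.lieBracketWithin_univ (V := coord c X) (W := coord c Y)) v

theorem coord_eq_sum {ι : Type*}
    (s : Finset ι) (k : ι → ℝ) {E : ι → VField m M}
    (h : X ((chartAt (EuclideanSpace ℝ (Fin m)) c).symm v) =
      ∑ a ∈ s, k a • E a ((chartAt (EuclideanSpace ℝ (Fin m)) c).symm v)) :
    coord c X v = ∑ a ∈ s, k a • coord c (E a) v := by
  simp only [coord, VectorField.mpullback_apply]
  rw [h, map_sum]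
  exact Finset.sum_congr rfl fun a _ ↦ map_smul _ _ _

theorem fderiv_comp_chart_symm (hv : v ∈ (chartAt (EuclideanSpace ℝ (Fin m)) c).target)
    {f : M → ℝ} (hf : MDifferentiableAt (𝓡 m) 𝓘(ℝ) f
      ((chartAt (EuclideanSpace ℝ (Fin m)) c).symm v)) :
    DifferentiableAt ℝ (f ∘ (chartAt (EuclideanSpace ℝ (Fin m)) c).symm) v ∧
    fderiv ℝ (f ∘ (chartAt (EuclideanSpace ℝ (Fin m)) c).symm) v (coord c X v) =
      dirDeriv X f ((chartAt (EuclideanSpace ℝ (Fin m)) c).symm v) := by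
  have hs := (contMDiffAt_chart_symm hv).mdifferentiableAt (by simp)
  refine ⟨mdifferentiableAt_iff_differentiableAt.1 (hf.comp v hs), ?_⟩
  rw [← mfderiv_eq_fderiv, mfderiv_comp v hf hs]
  change mfderiv (𝓡 m) 𝓘(ℝ) f _ (mfderiv (𝓡 m) (𝓡 m) _ v (coord c X v)) = _
  rw [mfderiv_coord hv]
  rfl

variable [RiemannianBundle (fun x : M ↦ TangentSpace (𝓡 m) x)]

/-! ### The density of the Riemannian measure -/

/-- Change of basis in a Gram determinant. -/
theorem det_gram_eq {W : Type*} [NormedAddCommGroup W] [InnerProductSpace ℝ W]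
    (L : EuclideanSpace ℝ (Fin m) →ₗ[ℝ] W) (b : Fin m → EuclideanSpace ℝ (Fin m)) :
    (Matrix.of fun i j : Fin m ↦ (inner ℝ (L (b i)) (L (b j)) : ℝ)).det =
      (Matrix.of fun a i ↦ b a i).det ^ 2 *
        (Matrix.of fun i j : Fin m ↦ (inner ℝ (L (EuclideanSpace.single i (1 : ℝ)))
          (L (EuclideanSpace.single j (1 : ℝ))) : ℝ)).det := by
  have hb : ∀ a, b a = ∑ i, b a i • EuclideanSpace.single i (1 : ℝ) := by
    intro a
    conv_lhs => rw [← (EuclideanSpace.basisFun (Fin m) ℝ).sum_repr (b a)]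
    simp
  have : (Matrix.of fun i j : Fin m ↦ (inner ℝ (L (b i)) (L (b j)) : ℝ)) =
      (Matrix.of fun a i ↦ b a i) *
        (Matrix.of fun i j : Fin m ↦ (inner ℝ (L (EuclideanSpace.single i (1 : ℝ)))
          (L (EuclideanSpace.single j (1 : ℝ))) : ℝ)) * (Matrix.of fun a i ↦ b a i).transpose := by
    ext i j
    simp only [Matrix.mul_apply, Matrix.of_apply, Matrix.transpose_apply]
    conv_lhs => rw [hb i, hb j]
    simp only [map_sum, map_smul, sum_inner, inner_sum, inner_smul_left, inner_smul_right,
      conj_trivial]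
    exact Finset.sum_congr rfl fun _ _ ↦ mul_comm _ _
  rw [this, Matrix.det_mul, Matrix.det_mul, Matrix.det_transpose]
  ring

/-- The matrix of the frame `E` in the coordinates of the chart at `c`. -/
def frameMatrix (c : M) (E : Fin m → VField m M) (v : EuclideanSpace ℝ (Fin m)) :
    Fin m → Fin m → ℝ := fun a i ↦ coord c (E a) v i

theorem det_frameMatrix_sq_mul_gramDet {U : Set M} {E : Fin m → VField m M} (hE : IsFrame U E)
    (hv : v ∈ (chartAt (EuclideanSpace ℝ (Fin m)) c).target)
    (hvU : (chartAt (EuclideanSpace ℝ (Fin m)) c).symm v ∈ U) :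
    (Matrix.of (frameMatrix c E v)).det ^ 2 * gramDet c v = 1 := by
  have h := det_gram_eq (W := TangentSpace (𝓡 m) ((chartAt (EuclideanSpace ℝ (Fin m)) c).symm v))
    (mfderiv (𝓡 m) (𝓡 m) (chartAt (EuclideanSpace ℝ (Fin m)) c).symm v).toLinearMap
    (fun a ↦ coord c (E a) v)
  have h1 : (Matrix.of fun a b : Fin m ↦ (inner ℝ
      (mfderiv (𝓡 m) (𝓡 m) (chartAt (EuclideanSpace ℝ (Fin m)) c).symm v (coord c (E a) v))
      (mfderiv (𝓡 m) (𝓡 m) (chartAt (EuclideanSpace ℝ (Fin m)) c).symm v (coord c (E b) v)) : ℝ))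
        = 1 := by
    ext a b
    simp only [Matrix.of_apply, mfderiv_coord hv]
    rw [Matrix.one_apply]
    exact hE.inner_eq a b _ hvU
  refine h.symm.trans ?_
  exact (congrArg Matrix.det h1).trans Matrix.det_one

end Coordinates

/-! ### The divergence in coordinates -/

section Divergence

/-- The Euclidean divergence of a field on `ℝ^m`. -/
def euclDiv {m : ℕ} (Y : EuclideanSpace ℝ (Fin m) → EuclideanSpace ℝ (Fin m))
    (v : EuclideanSpace ℝ (Fin m)) : ℝ :=
  ∑ i, fderiv ℝ Y v (EuclideanSpace.single i 1) i

theorem euclDiv_smul {m : ℕ} {Y : EuclideanSpace ℝ (Fin m) → EuclideanSpace ℝ (Fin m)}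
    {h : EuclideanSpace ℝ (Fin m) → ℝ} {v : EuclideanSpace ℝ (Fin m)}
    (hh : DifferentiableAt ℝ h v) (hY : DifferentiableAt ℝ Y v) :
    euclDiv (fun v' ↦ h v' • Y v') v = fderiv ℝ h v (Y v) + h v * euclDiv Y v := by
  have hY' : Y v = ∑ i, Y v i • EuclideanSpace.single i (1 : ℝ) := by
    conv_lhs => rw [← (EuclideanSpace.basisFun (Fin m) ℝ).sum_repr (Y v)]
    simp
  have h1 : fderiv ℝ h v (Y v) = ∑ i, fderiv ℝ h v (EuclideanSpace.single i 1) * Y v i := by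
    conv_lhs => rw [hY']
    rw [map_sum]
    exact Finset.sum_congr rfl fun i _ ↦ by rw [map_smul, smul_eq_mul, mul_comm]
  simp only [euclDiv]
  rw [fderiv_fun_smul hh hY, h1, Finset.mul_sum, ← Finset.sum_add_distrib]
  refine Finset.sum_congr rfl fun i _ ↦ ?_
  simp [add_comm]

theorem apply_fderiv {m : ℕ} {V : Type*} [NormedAddCommGroup V] [NormedSpace ℝ V]
    {Y : V → EuclideanSpace ℝ (Fin m)} {v : V} (hY : DifferentiableAt ℝ Y v) (w : V) (i : Fin m) :
    fderiv ℝ (fun v' ↦ Y v' i) v w = fderiv ℝ Y v w i := by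
  have := ((EuclideanSpace.proj i : EuclideanSpace ℝ (Fin m) →L[ℝ] ℝ).hasFDerivAt
    (x := Y v)).comp v hY.hasFDerivAt
  have h2 : (fun v' ↦ Y v' i) =
    (EuclideanSpace.proj i : EuclideanSpace ℝ (Fin m) →L[ℝ] ℝ) ∘ Y := rfl
  rw [h2, this.fderiv]
  rfl

variable {m : ℕ} {M : Type*} [TopologicalSpace M] [ChartedSpace (EuclideanSpace ℝ (Fin m)) M]
  [IsManifold (𝓡 m) ∞ M] [RiemannianBundle (fun x : M ↦ TangentSpace (𝓡 m) x)]

/-- The density `√(det g)` of the Riemannian measure in the preferred chart at `c`. -/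
def density (c : M) (v : EuclideanSpace ℝ (Fin m)) : ℝ := √(gramDet c v)

variable {c : M} {X Y : VField m M} {v : EuclideanSpace ℝ (Fin m)} {U : Set M}
  {E : Fin m → VField m M}

theorem det_frameMatrix_ne_zero (hE : IsFrame U E)
    (hv : v ∈ (chartAt (EuclideanSpace ℝ (Fin m)) c).target)
    (hvU : (chartAt (EuclideanSpace ℝ (Fin m)) c).symm v ∈ U) :
    (Matrix.of (frameMatrix c E v)).det ≠ 0 := by
  intro h0
  have := det_frameMatrix_sq_mul_gramDet hE hv hvU
  simp [h0] at this

theorem density_eq (hE : IsFrame U E) (hv : v ∈ (chartAt (EuclideanSpace ℝ (Fin m)) c).target)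
    (hvU : (chartAt (EuclideanSpace ℝ (Fin m)) c).symm v ∈ U) :
    density c v = |(Matrix.of (frameMatrix c E v)).det|⁻¹ := by
  have := det_frameMatrix_sq_mul_gramDet hE hv hvU
  rw [density, eq_inv_of_mul_eq_one_right this, Real.sqrt_inv, Real.sqrt_sq_eq_abs]

theorem density_pos (hE : IsFrame U E) (hv : v ∈ (chartAt (EuclideanSpace ℝ (Fin m)) c).target)
    (hvU : (chartAt (EuclideanSpace ℝ (Fin m)) c).symm v ∈ U) : 0 < density c v := by
  rw [density_eq hE hv hvU]
  exact inv_pos.2 (abs_pos.2 (det_frameMatrix_ne_zero hE hv hvU))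

theorem eventually_mem_chart (hU : IsOpen U)
    (hv : v ∈ (chartAt (EuclideanSpace ℝ (Fin m)) c).target)
    (hvU : (chartAt (EuclideanSpace ℝ (Fin m)) c).symm v ∈ U) :
    ∀ᶠ v' in 𝓝 v, v' ∈ (chartAt (EuclideanSpace ℝ (Fin m)) c).target ∧
      (chartAt (EuclideanSpace ℝ (Fin m)) c).symm v' ∈ U :=
  ((chartAt (EuclideanSpace ℝ (Fin m)) c).isOpen_inter_preimage_symm hU).mem_nhds ⟨hv, hvU⟩

theorem contDiffAt_frameMatrix (hE : IsFrame U E)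
    (hv : v ∈ (chartAt (EuclideanSpace ℝ (Fin m)) c).target)
    (hvU : (chartAt (EuclideanSpace ℝ (Fin m)) c).symm v ∈ U) :
    ContDiffAt ℝ ∞ (frameMatrix c E) v := by
  refine contDiffAt_pi.2 fun a ↦ contDiffAt_pi.2 fun i ↦ ?_
  exact (EuclideanSpace.proj i : EuclideanSpace ℝ (Fin m) →L[ℝ] ℝ).contDiff.contDiffAt.comp v
    (contDiffAt_coord hv hE.isOpen (hE.smooth a) hvU)

theorem contDiffAt_density (hE : IsFrame U E)
    (hv : v ∈ (chartAt (EuclideanSpace ℝ (Fin m)) c).target)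
    (hvU : (chartAt (EuclideanSpace ℝ (Fin m)) c).symm v ∈ U) :
    ContDiffAt ℝ ∞ (density c) v := by
  have h0 := det_frameMatrix_ne_zero hE hv hvU
  have hdet : ContDiffAt ℝ ∞ (fun v' ↦ (Matrix.of (frameMatrix c E v')).det) v := by
    have hB := contDiffAt_frameMatrix hE hv hvU
    simp only [Matrix.det_apply]
    refine ContDiffAt.sum fun σ _ ↦ ContDiffAt.const_smul _ (contDiffAt_prod fun i _ ↦ ?_)
    exact contDiffAt_pi.1 (contDiffAt_pi.1 hB (σ i)) i
  have habs : ContDiffAt ℝ ∞ (fun v' ↦ |(Matrix.of (frameMatrix c E v')).det|) v :=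
    ContDiffAt.comp (g := fun y : ℝ ↦ |y|) v (contDiffAt_abs h0) hdet
  have := habs.inv (abs_ne_zero.2 h0)
  refine this.congr_of_eventuallyEq ?_
  filter_upwards [eventually_mem_chart hE.isOpen hv hvU] with v' hv'
  exact density_eq hE hv'.1 hv'.2

variable [IsContMDiffRiemannianBundle (𝓡 m) ∞ (EuclideanSpace ℝ (Fin m))
    (fun x : M ↦ TangentSpace (𝓡 m) x)]

/-- `√(det g) div X = ∑_i ∂_i (√(det g) X^i)`. In the orthonormal frame, `√(det g)` is the inverse
of the determinant of the frame, whose logarithmic derivative is given by Jacobi's formula, and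
`div X = -∑_a ⟨[X, E_a], E_a⟩`. -/
theorem density_mul_divAlong (hE : IsFrame U E)
    (hv : v ∈ (chartAt (EuclideanSpace ℝ (Fin m)) c).target)
    (hvU : (chartAt (EuclideanSpace ℝ (Fin m)) c).symm v ∈ U) (hX : SmoothOn X U) :
    fderiv ℝ (density c) v (coord c X v) + density c v * euclDiv (coord c X) v =
      density c v * divAlong E X ((chartAt (EuclideanSpace ℝ (Fin m)) c).symm v) := by
  set x := (chartAt (EuclideanSpace ℝ (Fin m)) c).symm v with hx
  have hU := hE.isOpen
  set B := frameMatrix c E with hB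
  set C : Matrix (Fin m) (Fin m) ℝ := (Matrix.of (B v))⁻¹ with hC
  have hdet : (Matrix.of (B v)).det ≠ 0 := det_frameMatrix_ne_zero hE hv hvU
  have hBC : Matrix.of (B v) * C = 1 := Matrix.mul_nonsing_inv _ (isUnit_iff_ne_zero.2 hdet)
  have hCB : C * Matrix.of (B v) = 1 := Matrix.nonsing_inv_mul _ (isUnit_iff_ne_zero.2 hdet)
  have hBd : DifferentiableAt ℝ B v :=
    (contDiffAt_frameMatrix hE hv hvU).differentiableAt (by simp)
  have hEd : ∀ a, DifferentiableAt ℝ (coord c (E a)) v := fun a ↦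
    (contDiffAt_coord hv hU (hE.smooth a) hvU).differentiableAt (by simp)
  have hwd : DifferentiableAt ℝ (density c) v :=
    (contDiffAt_density hE hv hvU).differentiableAt (by simp)
  set Xh := coord c X v with hXh
  set T := ∑ a, ∑ i, fderiv ℝ B v Xh a i * C i a with hT
  obtain ⟨hgd, hg⟩ := fderiv_det hBd hBC Xh
  set g : EuclideanSpace ℝ (Fin m) → ℝ := fun v' ↦ (Matrix.of (B v')).det with hgdef
  -- Differentiate `density² det² = 1`.
  have hw : fderiv ℝ (density c) v Xh = -density c v * T := by
    have hone : (fun v' ↦ (density c v' * g v') ^ 2) =ᶠ[𝓝 v] fun _ ↦ 1 := by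
      filter_upwards [eventually_mem_chart hU hv hvU] with v' hv'
      have h0 : |g v'| ≠ 0 := abs_ne_zero.2 (det_frameMatrix_ne_zero hE hv'.1 hv'.2)
      rw [density_eq hE hv'.1 hv'.2, mul_pow, ← sq_abs (g v')]
      change (|g v'|⁻¹) ^ 2 * |g v'| ^ 2 = 1
      rw [← mul_pow, inv_mul_cancel₀ h0, one_pow]
    have h1 := hone.fderiv_eq (𝕜 := ℝ)
    have h2 := (((hwd.hasFDerivAt.mul hgd.hasFDerivAt).pow 2).fderiv).symm.trans h1
    have h3 := congrArg (fun L : EuclideanSpace ℝ (Fin m) →L[ℝ] ℝ ↦ L Xh) h2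
    simp [hg] at h3
    have hpos := (density_pos hE hv hvU).ne'
    have hg0 : g v ≠ 0 := hdet
    have h4 : 2 * (density c v * g v) * g v *
        (fderiv ℝ (density c) v Xh + density c v * T) = 0 := by
      have hgv : (Matrix.of (B v)).det = g v := rfl
      rw [hgv, ← hT] at h3
      linear_combination h3
    have := (mul_eq_zero.1 h4).resolve_left (by simp [hpos, hg0])
    linarith
  -- The coefficients of a field in the frame.
  have hcoef : ∀ (V : VField m M) (a : Fin m), ip V (E a) x = ∑ i, coord c V v i * C i a := by
    intro V a
    have h1 := coord_eq_sum (c := c) (v := v) Finset.univ _ (hE.eq_sum hvU V)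
    have h2 : ∀ i, coord c V v i = ∑ b, ip V (E b) x * B v b i := by
      intro i
      rw [h1]
      simp [hB, frameMatrix]
    simp only [h2, Finset.sum_mul]
    rw [Finset.sum_comm]
    have h3 : ∀ b, ∑ i, ip V (E b) x * B v b i * C i a = ip V (E b) x * if b = a then 1 else 0 := by
      intro b
      rw [← Matrix.one_apply, ← hBC, Matrix.mul_apply, Finset.mul_sum]
      exact Finset.sum_congr rfl fun i _ ↦ by rw [mul_assoc]; rfl
    simp [h3]
  have hXd : DiffAt X x := hX.diffAt hU hvU
  have hbr : ∀ a, ip (bracket X (E a)) (E a) x = ∑ i, fderiv ℝ B v Xh a i * C i a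
      - ∑ i, fderiv ℝ (coord c X) v (coord c (E a) v) i * C i a := by
    intro a
    rw [hcoef, coord_bracket hv hXd ((hE.smooth a).diffAt hU hvU), ← Finset.sum_sub_distrib]
    refine Finset.sum_congr rfl fun i _ ↦ ?_
    have h1 : fderiv ℝ B v Xh a i = fderiv ℝ (coord c (E a)) v Xh i := by
      rw [← apply_fderiv (hEd a)]
      have h2 : HasFDerivAt (fun v' ↦ B v' a i) _ v :=
        (hasFDerivAt_pi'.1 (hasFDerivAt_pi'.1 hBd.hasFDerivAt a) i)
      exact (congrArg (fun L : EuclideanSpace ℝ (Fin m) →L[ℝ] ℝ ↦ L Xh) h2.fderiv).symm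
    rw [h1, ← sub_mul]
    rfl
  have hdivX : ∑ a, ∑ i, fderiv ℝ (coord c X) v (coord c (E a) v) i * C i a =
      euclDiv (coord c X) v := by
    have h1 : ∀ a i, fderiv ℝ (coord c X) v (coord c (E a) v) i =
        ∑ j, B v a j * fderiv ℝ (coord c X) v (EuclideanSpace.single j 1) i := by
      intro a i
      have h2 : coord c (E a) v = ∑ j, B v a j • EuclideanSpace.single j (1 : ℝ) := by
        conv_lhs => rw [← (EuclideanSpace.basisFun (Fin m) ℝ).sum_repr (coord c (E a) v)]
        simp [hB, frameMatrix]
      rw [h2, map_sum]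
      simp
    simp only [h1, Finset.sum_mul]
    rw [Finset.sum_comm]
    refine Finset.sum_congr rfl fun i _ ↦ ?_
    rw [Finset.sum_comm]
    have h3 : ∀ j, ∑ a, B v a j * fderiv ℝ (coord c X) v (EuclideanSpace.single j 1) i * C i a =
        fderiv ℝ (coord c X) v (EuclideanSpace.single j 1) i * if i = j then 1 else 0 := by
      intro j
      rw [← Matrix.one_apply, ← hCB, Matrix.mul_apply, Finset.mul_sum]
      refine Finset.sum_congr rfl fun a _ ↦ ?_
      rw [Matrix.of_apply]
      ring
    simp [h3]
  rw [divAlong_eq_neg_sum_bracket hE hvU hXd, hw]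
  simp only [hbr, Finset.sum_sub_distrib]
  rw [hdivX, ← hT]
  ring

/-- The Euclidean divergence of the coordinate expression of `f √(det g) X`. -/
theorem euclDiv_smul_coord (hE : IsFrame U E)
    (hv : v ∈ (chartAt (EuclideanSpace ℝ (Fin m)) c).target)
    (hvU : (chartAt (EuclideanSpace ℝ (Fin m)) c).symm v ∈ U) (hX : SmoothOn X U) {f : M → ℝ}
    (hf : MDifferentiableAt (𝓡 m) 𝓘(ℝ) f ((chartAt (EuclideanSpace ℝ (Fin m)) c).symm v)) :
    euclDiv (fun v' ↦ (f ((chartAt (EuclideanSpace ℝ (Fin m)) c).symm v') * density c v') •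
      coord c X v') v = density c v *
        (f ((chartAt (EuclideanSpace ℝ (Fin m)) c).symm v) *
            divAlong E X ((chartAt (EuclideanSpace ℝ (Fin m)) c).symm v) +
          dirDeriv X f ((chartAt (EuclideanSpace ℝ (Fin m)) c).symm v)) := by
  obtain ⟨hfd, hfX⟩ := fderiv_comp_chart_symm (X := X) hv hf
  have hwd : DifferentiableAt ℝ (density c) v :=
    (contDiffAt_density hE hv hvU).differentiableAt (by simp)
  have hXd : DifferentiableAt ℝ (coord c X) v :=
    (contDiffAt_coord hv hE.isOpen hX hvU).differentiableAt (by simp)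
  have hprod : DifferentiableAt ℝ
      (fun v' ↦ f ((chartAt (EuclideanSpace ℝ (Fin m)) c).symm v') * density c v') v :=
    hfd.mul hwd
  rw [euclDiv_smul hprod hXd]
  have h1 : fderiv ℝ (fun v' ↦ f ((chartAt (EuclideanSpace ℝ (Fin m)) c).symm v') * density c v') v
      (coord c X v) = f ((chartAt (EuclideanSpace ℝ (Fin m)) c).symm v) *
        fderiv ℝ (density c) v (coord c X v) + density c v *
          fderiv ℝ (f ∘ (chartAt (EuclideanSpace ℝ (Fin m)) c).symm) v (coord c X v) := by
    have := (hfd.hasFDerivAt.mul hwd.hasFDerivAt).fderiv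
    exact congrArg (fun L : EuclideanSpace ℝ (Fin m) →L[ℝ] ℝ ↦ L (coord c X v)) this
  have h2 := density_mul_divAlong hE hv hvU hX
  rw [h1, hfX]
  linear_combination f ((chartAt (EuclideanSpace ℝ (Fin m)) c).symm v) * h2

end Divergence

/-! ### The Riemannian measure in a chart -/

section ChartMeasure

variable {m : ℕ} {M : Type*} [TopologicalSpace M] [ChartedSpace (EuclideanSpace ℝ (Fin m)) M]
  [IsManifold (𝓡 m) ∞ M]

theorem coord_eq_mfderiv_chart {c : M} {X : VField m M} {v : EuclideanSpace ℝ (Fin m)}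
    (hv : v ∈ (chartAt (EuclideanSpace ℝ (Fin m)) c).target) :
    coord c X v = mfderiv (𝓡 m) (𝓡 m) (chartAt (EuclideanSpace ℝ (Fin m)) c)
      ((chartAt (EuclideanSpace ℝ (Fin m)) c).symm v)
      (X ((chartAt (EuclideanSpace ℝ (Fin m)) c).symm v)) := by
  rw [← mfderiv_coord (X := X) hv]
  have h := (mdifferentiable_chart (I := 𝓡 m) c).comp_symm_deriv hv
  exact (congrArg (fun L : EuclideanSpace ℝ (Fin m) →L[ℝ] EuclideanSpace ℝ (Fin m) ↦
    L (coord c X v)) h).symm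

/-- The transition map from the chart at `c` to the chart at `c'`. -/
def transition (c c' : M) (v : EuclideanSpace ℝ (Fin m)) : EuclideanSpace ℝ (Fin m) :=
  chartAt (EuclideanSpace ℝ (Fin m)) c' ((chartAt (EuclideanSpace ℝ (Fin m)) c).symm v)

variable {c c' : M} {v : EuclideanSpace ℝ (Fin m)}

theorem hasFDerivAt_transition (hv : v ∈ (chartAt (EuclideanSpace ℝ (Fin m)) c).target)
    (hv' : (chartAt (EuclideanSpace ℝ (Fin m)) c).symm v ∈
      (chartAt (EuclideanSpace ℝ (Fin m)) c').source) :
    HasFDerivAt (transition c c') (fderiv ℝ (transition c c') v) v := by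
  have h1 := (contMDiffAt_chart_symm hv).mdifferentiableAt (by simp)
  have h2 := mdifferentiableAt_atlas (I := 𝓡 m)
    (chart_mem_atlas (EuclideanSpace ℝ (Fin m)) c') hv'
  exact (mdifferentiableAt_iff_differentiableAt.1 (h2.comp v h1)).hasFDerivAt

theorem coord_transition {X : VField m M}
    (hv : v ∈ (chartAt (EuclideanSpace ℝ (Fin m)) c).target)
    (hv' : (chartAt (EuclideanSpace ℝ (Fin m)) c).symm v ∈
      (chartAt (EuclideanSpace ℝ (Fin m)) c').source) :
    coord c' X (transition c c' v) = fderiv ℝ (transition c c') v (coord c X v) := by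
  have hT : transition c c' v ∈ (chartAt (EuclideanSpace ℝ (Fin m)) c').target :=
    (chartAt (EuclideanSpace ℝ (Fin m)) c').map_source hv'
  have hsymm : (chartAt (EuclideanSpace ℝ (Fin m)) c').symm (transition c c' v) =
      (chartAt (EuclideanSpace ℝ (Fin m)) c).symm v :=
    (chartAt (EuclideanSpace ℝ (Fin m)) c').left_inv hv'
  have hcongr : ∀ y z : M, y = z →
      (mfderiv (𝓡 m) (𝓡 m) (chartAt (EuclideanSpace ℝ (Fin m)) c') y (X y) :
        EuclideanSpace ℝ (Fin m)) =
      mfderiv (𝓡 m) (𝓡 m) (chartAt (EuclideanSpace ℝ (Fin m)) c') z (X z) := by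
    rintro y z rfl; rfl
  have h1 := (contMDiffAt_chart_symm hv).mdifferentiableAt (by simp)
  have h2 := mdifferentiableAt_atlas (I := 𝓡 m)
    (chart_mem_atlas (EuclideanSpace ℝ (Fin m)) c') hv'
  have hchain := mfderiv_comp v h2 h1
  rw [coord_eq_mfderiv_chart hT, hcongr _ _ hsymm, ← mfderiv_coord (X := X) hv]
  have h3 : fderiv ℝ (transition c c') v = mfderiv (𝓡 m) (𝓡 m)
      (chartAt (EuclideanSpace ℝ (Fin m)) c' ∘ (chartAt (EuclideanSpace ℝ (Fin m)) c).symm) v :=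
    mfderiv_eq_fderiv.symm
  rw [h3, hchain]
  rfl

theorem det_of_map (T : EuclideanSpace ℝ (Fin m) →L[ℝ] EuclideanSpace ℝ (Fin m))
    (b : Fin m → EuclideanSpace ℝ (Fin m)) :
    (Matrix.of fun a i ↦ T (b a) i).det = T.det * (Matrix.of fun a i ↦ b a i).det := by
  set β := (EuclideanSpace.basisFun (Fin m) ℝ).toBasis
  have h : (Matrix.of fun a i ↦ T (b a) i) = (Matrix.of fun a i ↦ b a i) *
      (LinearMap.toMatrix β β T.toLinearMap).transpose := by
    ext a i
    have hb : b a = ∑ j, b a j • EuclideanSpace.single j (1 : ℝ) := by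
      conv_lhs => rw [← (EuclideanSpace.basisFun (Fin m) ℝ).sum_repr (b a)]
      simp
    rw [Matrix.of_apply, Matrix.mul_apply]
    conv_lhs => rw [hb, map_sum]
    simp [LinearMap.toMatrix_apply, β]
  rw [h, Matrix.det_mul, Matrix.det_transpose, LinearMap.det_toMatrix, mul_comm]

variable [RiemannianBundle (fun x : M ↦ TangentSpace (𝓡 m) x)] {U : Set M}
  {E : Fin m → VField m M}

theorem density_transition (hE : IsFrame U E)
    (hv : v ∈ (chartAt (EuclideanSpace ℝ (Fin m)) c).target)
    (hv' : (chartAt (EuclideanSpace ℝ (Fin m)) c).symm v ∈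
      (chartAt (EuclideanSpace ℝ (Fin m)) c').source)
    (hvU : (chartAt (EuclideanSpace ℝ (Fin m)) c).symm v ∈ U) :
    density c v = |(fderiv ℝ (transition c c') v).det| * density c' (transition c c' v) := by
  have hT : transition c c' v ∈ (chartAt (EuclideanSpace ℝ (Fin m)) c').target :=
    (chartAt (EuclideanSpace ℝ (Fin m)) c').map_source hv'
  have hsymm : (chartAt (EuclideanSpace ℝ (Fin m)) c').symm (transition c c' v) =
      (chartAt (EuclideanSpace ℝ (Fin m)) c).symm v :=
    (chartAt (EuclideanSpace ℝ (Fin m)) c').left_inv hv'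
  have hTU : (chartAt (EuclideanSpace ℝ (Fin m)) c').symm (transition c c' v) ∈ U := by
    rwa [hsymm]
  have h1 : (Matrix.of (frameMatrix c' E (transition c c' v))).det =
      (fderiv ℝ (transition c c') v).det * (Matrix.of (frameMatrix c E v)).det := by
    refine Eq.trans ?_ (det_of_map (fderiv ℝ (transition c c') v) fun a ↦ coord c (E a) v)
    congr 1
    ext a i
    simp only [Matrix.of_apply, frameMatrix, coord_transition hv hv']
  have h2 := det_frameMatrix_ne_zero hE hT hTU
  rw [density_eq hE hv hvU, density_eq hE hT hTU]
  rw [h1] at h2 ⊢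
  have h3 : |(fderiv ℝ (transition c c') v).det| ≠ 0 := abs_ne_zero.2 (left_ne_zero_of_mul h2)
  rw [abs_mul, mul_inv, ← mul_assoc, mul_inv_cancel₀ h3, one_mul]

/-- Every point lies in the domain of a smooth orthonormal frame. -/
def HasFrames (m : ℕ) (M : Type*) [TopologicalSpace M]
    [ChartedSpace (EuclideanSpace ℝ (Fin m)) M] [IsManifold (𝓡 m) ∞ M]
    [RiemannianBundle (fun x : M ↦ TangentSpace (𝓡 m) x)] : Prop :=
  ∀ x : M, ∃ (U : Set M) (E : Fin m → VField m M), x ∈ U ∧ IsFrame U E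

theorem continuousOn_density (hfr : HasFrames m M) (c : M) :
    ContinuousOn (density c) (chartAt (EuclideanSpace ℝ (Fin m)) c).target := by
  intro v hv
  obtain ⟨U, E, hvU, hE⟩ := hfr ((chartAt (EuclideanSpace ℝ (Fin m)) c).symm v)
  exact (contDiffAt_density hE hv hvU).continuousAt.continuousWithinAt

variable [MeasurableSpace M] [BorelSpace M]

theorem aemeasurable_chart_symm (c : M) :
    AEMeasurable (chartAt (EuclideanSpace ℝ (Fin m)) c).symm
      ((volume : Measure (EuclideanSpace ℝ (Fin m))).restrict
        (chartAt (EuclideanSpace ℝ (Fin m)) c).target) :=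
  (chartAt (EuclideanSpace ℝ (Fin m)) c).continuousOn_symm.aemeasurable
    (chartAt (EuclideanSpace ℝ (Fin m)) c).open_target.measurableSet

theorem aemeasurable_chart_symm_withDensity (c : M) :
    AEMeasurable (chartAt (EuclideanSpace ℝ (Fin m)) c).symm
      (((volume : Measure (EuclideanSpace ℝ (Fin m))).restrict
        (chartAt (EuclideanSpace ℝ (Fin m)) c).target).withDensity
          fun v ↦ ENNReal.ofReal (density c v)) :=
  (aemeasurable_chart_symm c).mono_ac (withDensity_absolutelyContinuous _ _)

theorem chartVolume_apply (c : M) {s : Set M} (hs : MeasurableSet s) :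
    chartVolume (m := m) c s =
      ∫⁻ v in (chartAt (EuclideanSpace ℝ (Fin m)) c).symm ⁻¹' s ∩
        (chartAt (EuclideanSpace ℝ (Fin m)) c).target, ENNReal.ofReal (density c v) := by
  have h := Measure.map_apply_of_aemeasurable (aemeasurable_chart_symm_withDensity (m := m) c) hs
  refine h.trans ?_
  rw [withDensity_apply', Measure.restrict_restrict'
      (chartAt (EuclideanSpace ℝ (Fin m)) c).open_target.measurableSet]

theorem chartVolume_compl_source (c : M) :
    chartVolume (m := m) c (chartAt (EuclideanSpace ℝ (Fin m)) c).sourceᶜ = 0 := by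
  rw [chartVolume_apply c (chartAt (EuclideanSpace ℝ (Fin m)) c).open_source.measurableSet.compl]
  have : (chartAt (EuclideanSpace ℝ (Fin m)) c).symm ⁻¹'
      (chartAt (EuclideanSpace ℝ (Fin m)) c).sourceᶜ ∩
        (chartAt (EuclideanSpace ℝ (Fin m)) c).target = ∅ := by
    ext v
    simp only [Set.mem_inter_iff, Set.mem_preimage, Set.mem_compl_iff, Set.mem_empty_iff_false,
      iff_false, not_and]
    exact fun h hv ↦ h ((chartAt (EuclideanSpace ℝ (Fin m)) c).map_target hv)
  rw [this]
  simp

theorem measurableSet_preimage_chart_symm (c : M) {s : Set M} (hs : MeasurableSet s) :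
    MeasurableSet ((chartAt (EuclideanSpace ℝ (Fin m)) c).symm ⁻¹' s ∩
      (chartAt (EuclideanSpace ℝ (Fin m)) c).target) := by
  have ht := (chartAt (EuclideanSpace ℝ (Fin m)) c).open_target.measurableSet
  have h1 := (continuousOn_iff_continuous_domRestrict.1
    (chartAt (EuclideanSpace ℝ (Fin m)) c).continuousOn_symm).measurable hs
  have h2 := ht.subtype_image h1
  convert h2 using 1
  ext v
  simp only [Set.mem_inter_iff, Set.mem_preimage, Set.mem_image, Subtype.exists]
  constructor
  · rintro ⟨h3, h4⟩
    exact ⟨v, h4, h3, rfl⟩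
  · rintro ⟨w, hw, h3, rfl⟩
    exact ⟨h3, hw⟩

/-- The measures `chartVolume` of two charts agree on the overlap of their domains. -/
theorem chartVolume_eq_of_subset (hfr : HasFrames m M) (c c' : M) {s : Set M}
    (hs : MeasurableSet s) (hc : s ⊆ (chartAt (EuclideanSpace ℝ (Fin m)) c).source)
    (hc' : s ⊆ (chartAt (EuclideanSpace ℝ (Fin m)) c').source) :
    chartVolume (m := m) c s = chartVolume (m := m) c' s := by
  rw [chartVolume_apply c hs, chartVolume_apply c' hs]
  set A := (chartAt (EuclideanSpace ℝ (Fin m)) c).symm ⁻¹' s ∩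
    (chartAt (EuclideanSpace ℝ (Fin m)) c).target with hA
  have hAm : MeasurableSet A := measurableSet_preimage_chart_symm c hs
  have himage : (chartAt (EuclideanSpace ℝ (Fin m)) c').symm ⁻¹' s ∩
      (chartAt (EuclideanSpace ℝ (Fin m)) c').target = transition c c' '' A := by
    ext w
    constructor
    · rintro ⟨h1, h2⟩
      refine ⟨chartAt (EuclideanSpace ℝ (Fin m)) c
        ((chartAt (EuclideanSpace ℝ (Fin m)) c').symm w), ⟨?_, ?_⟩, ?_⟩
      · rw [Set.mem_preimage, (chartAt (EuclideanSpace ℝ (Fin m)) c).left_inv (hc h1)]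
        exact h1
      · exact (chartAt (EuclideanSpace ℝ (Fin m)) c).map_source (hc h1)
      · rw [transition, (chartAt (EuclideanSpace ℝ (Fin m)) c).left_inv (hc h1),
          (chartAt (EuclideanSpace ℝ (Fin m)) c').right_inv h2]
    · rintro ⟨v, ⟨h1, h2⟩, rfl⟩
      refine ⟨?_, (chartAt (EuclideanSpace ℝ (Fin m)) c').map_source (hc' h1)⟩
      rw [Set.mem_preimage, transition,
        (chartAt (EuclideanSpace ℝ (Fin m)) c').left_inv (hc' h1)]
      exact h1
  have hinj : Set.InjOn (transition c c') A := by
    intro v hv w hw h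
    have h1 := (chartAt (EuclideanSpace ℝ (Fin m)) c').injOn (hc' hv.1) (hc' hw.1) h
    exact (chartAt (EuclideanSpace ℝ (Fin m)) c).symm.injOn hv.2 hw.2 h1
  rw [himage, lintegral_image_eq_lintegral_abs_det_fderiv_mul volume hAm
    (fun v hv ↦ (hasFDerivAt_transition hv.2 (hc' hv.1)).hasFDerivWithinAt) hinj]
  refine setLIntegral_congr_fun hAm fun v hv ↦ ?_
  obtain ⟨U, E, hvU, hE⟩ := hfr ((chartAt (EuclideanSpace ℝ (Fin m)) c).symm v)
  rw [density_transition hE hv.2 (hc' hv.1) hvU, ENNReal.ofReal_mul (abs_nonneg _)]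

/-- On the domain of a chart, the Riemannian measure is given by the density of that chart. -/
theorem restrict_riemannianVolume (hfr : HasFrames m M) (c : M) :
    (riemannianVolume m M).restrict (chartAt (EuclideanSpace ℝ (Fin m)) c).source =
      chartVolume (m := m) c := by
  set S := (chartAt (EuclideanSpace ℝ (Fin m)) c).source with hS
  have hSm : MeasurableSet S :=
    (chartAt (EuclideanSpace ℝ (Fin m)) c).open_source.measurableSet
  have hself : (chartVolume (m := m) c).restrict S = chartVolume (m := m) c :=
    Measure.restrict_eq_self_of_ae_mem (chartVolume_compl_source c)
  refine le_antisymm ?_ ?_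
  · -- An upper bound of all the chart measures that is no larger than `chartVolume c` on `S`.
    have hub : riemannianVolume m M ≤
        chartVolume (m := m) c + (⊤ : Measure M).restrict Sᶜ := by
      refine iSup_le fun c' ↦ Measure.le_iff.2 fun s hs ↦ ?_
      rw [← measure_inter_add_sdiff s hSm, Measure.add_apply, Measure.restrict_apply hs]
      refine add_le_add ?_ ?_
      · set S' := (chartAt (EuclideanSpace ℝ (Fin m)) c').source with hS'
        have hSm' : MeasurableSet S' :=
          (chartAt (EuclideanSpace ℝ (Fin m)) c').open_source.measurableSet
        calc chartVolume (m := m) c' (s ∩ S)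
            ≤ chartVolume (m := m) c' (s ∩ S ∩ S') + chartVolume (m := m) c' S'ᶜ := by
              rw [← measure_inter_add_sdiff (s ∩ S) hSm']
              exact add_le_add le_rfl (measure_mono (Set.sdiff_subset_compl _ _))
          _ = chartVolume (m := m) c' (s ∩ S ∩ S') := by
              rw [chartVolume_compl_source, add_zero]
          _ = chartVolume (m := m) c (s ∩ S ∩ S') :=
              (chartVolume_eq_of_subset hfr c c' ((hs.inter hSm).inter hSm')
                (fun _ h ↦ h.1.2) fun _ h ↦ h.2).symm
          _ ≤ chartVolume (m := m) c s := measure_mono fun _ h ↦ h.1.1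
      · rw [Set.sdiff_eq]
        exact Measure.le_iff'.1 le_top _
    calc (riemannianVolume m M).restrict S
        ≤ (chartVolume (m := m) c + (⊤ : Measure M).restrict Sᶜ).restrict S :=
          Measure.restrict_mono le_rfl hub
      _ = chartVolume (m := m) c := by
          rw [Measure.restrict_add, hself, Measure.restrict_restrict hSm, Set.inter_compl_self,
            Measure.restrict_empty, add_zero]
  · rw [← hself]
    exact Measure.restrict_mono le_rfl (le_iSup (fun c : M ↦ chartVolume (m := m) c) c)

end ChartMeasure

/-! ### The divergence theorem -/

section DivergenceTheorem

theorem integral_euclDiv {m : ℕ} {Y : EuclideanSpace ℝ (Fin m) → EuclideanSpace ℝ (Fin m)}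
    (hY : ContDiff ℝ 1 Y) (hc : HasCompactSupport Y) :
    Continuous (euclDiv Y) ∧ Integrable (euclDiv Y) ∧ ∫ v, euclDiv Y v = 0 := by
  have hd : Differentiable ℝ Y := hY.differentiable one_ne_zero
  set y : Fin m → EuclideanSpace ℝ (Fin m) → ℝ := fun i v ↦ Y v i with hy
  have hys : ∀ i, ContDiff ℝ 1 (y i) := fun i ↦
    (EuclideanSpace.proj i : EuclideanSpace ℝ (Fin m) →L[ℝ] ℝ).contDiff.comp hY
  have hyc : ∀ i, HasCompactSupport (y i) := fun i ↦
    hc.comp_left (g := fun w : EuclideanSpace ℝ (Fin m) ↦ w i) rfl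
  have hdiv : euclDiv Y = fun v ↦ ∑ i, fderiv ℝ (y i) v (EuclideanSpace.single i 1) := by
    funext v
    exact Finset.sum_congr rfl fun i _ ↦ (apply_fderiv (hd v) _ i).symm
  have hcont : ∀ i, Continuous fun v ↦ fderiv ℝ (y i) v (EuclideanSpace.single i 1) := fun i ↦
    ((hys i).continuous_fderiv one_ne_zero).clm_apply continuous_const
  have hint : ∀ i, Integrable fun v ↦ fderiv ℝ (y i) v (EuclideanSpace.single i 1) := fun i ↦
    (hcont i).integrable_of_hasCompactSupport ((hyc i).fderiv_apply ℝ _)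
  have hzero : ∀ i, ∫ v, fderiv ℝ (y i) v (EuclideanSpace.single i 1) = 0 := by
    intro i
    -- Integration by parts against the constant function `1`.
    have := integral_mul_fderiv_eq_neg_fderiv_mul_of_integrable (𝕜 := ℝ)
      (μ := (volume : Measure (EuclideanSpace ℝ (Fin m)))) (f := fun _ ↦ (1 : ℝ)) (g := y i)
      (v := EuclideanSpace.single i 1) (by simp) (by simpa using hint i)
      (by simpa using (hys i).continuous.integrable_of_hasCompactSupport (hyc i))
      (fun _ _ ↦ differentiableAt_const _) (fun v _ ↦ (hys i).differentiable one_ne_zero v)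
    simpa using this
  rw [hdiv]
  refine ⟨continuous_finsetSum _ fun i _ ↦ hcont i, integrable_finsetSum _ fun i _ ↦ hint i, ?_⟩
  rw [integral_finsetSum _ fun i _ ↦ hint i]
  simp [hzero]

variable {m : ℕ} {M : Type*} [TopologicalSpace M] [T2Space M] [CompactSpace M]
  [ChartedSpace (EuclideanSpace ℝ (Fin m)) M] [IsManifold (𝓡 m) ∞ M]
  [MeasurableSpace M] [BorelSpace M]
  [RiemannianBundle (fun x : M ↦ TangentSpace (𝓡 m) x)]
  [IsContMDiffRiemannianBundle (𝓡 m) ∞ (EuclideanSpace ℝ (Fin m))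
    (fun x : M ↦ TangentSpace (𝓡 m) x)]
  {U : M → Set M} {E : M → Fin m → VField m M} {X : VField m M}

/-- The divergence theorem for `f X`, where `f` has its support in the domain of a chart. -/
theorem integral_mul_divAlong_add_dirDeriv (hU : ∀ x, x ∈ U x) (hE : ∀ x, IsFrame (U x) (E x))
    (hX : SmoothOn X Set.univ) (c : M) {f : M → ℝ} (hf : ContMDiff (𝓡 m) 𝓘(ℝ) ∞ f)
    (hfc : tsupport f ⊆ (chartAt (EuclideanSpace ℝ (Fin m)) c).source) :
    Integrable (fun x ↦ f x * divAlong (E x) X x + dirDeriv X f x) (riemannianVolume m M) ∧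
      ∫ x, (f x * divAlong (E x) X x + dirDeriv X f x) ∂(riemannianVolume m M) = 0 := by
  set φ := chartAt (EuclideanSpace ℝ (Fin m)) c with hφ
  set g : M → ℝ := fun x ↦ f x * divAlong (E x) X x + dirDeriv X f x with hg
  have hfr : HasFrames m M := fun x ↦ ⟨U x, E x, hU x, hE x⟩
  have hXU : ∀ x, SmoothOn X (U x) := fun x ↦ ContMDiffOn.mono hX (Set.subset_univ _)
  have hfd : ∀ x, MDifferentiableAt (𝓡 m) 𝓘(ℝ) f x := fun x ↦ hf.mdifferentiableAt (by simp)
  -- The coordinate expression of `f √(det g) X`, extended by zero.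
  set Y₀ : EuclideanSpace ℝ (Fin m) → EuclideanSpace ℝ (Fin m) :=
    fun v ↦ (f (φ.symm v) * density c v) • coord c X v with hY₀
  set Y := φ.target.indicator Y₀ with hYdef
  set K := φ '' tsupport f with hK
  have hKc : IsCompact K :=
    (isClosed_tsupport f).isCompact.image_of_continuousOn (φ.continuousOn.mono hfc)
  have hYK : ∀ v, v ∉ K → Y v = 0 := by
    intro v hv
    by_cases hvt : v ∈ φ.target
    · have : f (φ.symm v) = 0 := by
        by_contra h0
        exact hv ⟨φ.symm v, subset_tsupport f h0, φ.right_inv hvt⟩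
      simp [hYdef, hvt, hY₀, this]
    · simp [hYdef, hvt]
  have hYt : ∀ v ∈ φ.target, Y =ᶠ[𝓝 v] Y₀ := fun v hv ↦
    Filter.mem_of_superset (φ.open_target.mem_nhds hv) fun w hw ↦ Set.indicator_of_mem hw _
  have hY0 : ∀ v, v ∉ φ.target → Y =ᶠ[𝓝 v] fun _ ↦ 0 := by
    intro v hv
    refine Filter.mem_of_superset (hKc.isClosed.isOpen_compl.mem_nhds ?_) hYK
    rintro ⟨x, hx, rfl⟩
    exact hv (φ.map_source (hfc hx))
  have hYsupp : HasCompactSupport Y := HasCompactSupport.intro hKc hYK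
  have hYs : ContDiff ℝ 1 Y := by
    refine contDiff_iff_contDiffAt.2 fun v ↦ ?_
    by_cases hv : v ∈ φ.target
    · refine ContDiffAt.congr_of_eventuallyEq ?_ (hYt v hv)
      have h1 : ContDiffAt ℝ ∞ (fun v ↦ f (φ.symm v)) v :=
        ((hf _).comp v (contMDiffAt_chart_symm hv)).contDiffAt
      exact ((h1.mul (contDiffAt_density (hE _) hv (hU _))).smul
        (contDiffAt_coord hv isOpen_univ hX (Set.mem_univ _))).of_le (by simp)
    · exact contDiffAt_const.congr_of_eventuallyEq (hY0 v hv)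
  obtain ⟨hdc, hdi, hd0⟩ := integral_euclDiv hYs hYsupp
  have hdivt : ∀ v ∈ φ.target, euclDiv Y v = density c v * g (φ.symm v) := by
    intro v hv
    have h1 : euclDiv Y v = euclDiv Y₀ v := by
      simp only [euclDiv]
      rw [(hYt v hv).fderiv_eq]
    rw [h1]
    exact euclDiv_smul_coord (hE _) hv (hU _) (hXU _) (hfd _)
  have hdiv0 : ∀ v, v ∉ φ.target → euclDiv Y v = 0 := by
    intro v hv
    simp only [euclDiv]
    rw [(hY0 v hv).fderiv_eq]
    simp
  have hg0 : ∀ x, x ∉ φ.source → g x = 0 := by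
    intro x hx
    have h1 : x ∉ tsupport f := fun h ↦ hx (hfc h)
    have h2 : f =ᶠ[𝓝 x] 0 := notMem_tsupport_iff_eventuallyEq.1 h1
    simp only [hg]
    rw [h2.self_of_nhds, dirDeriv_eq_zero_of_eventually_const (c := 0) h2]
    simp
  have hwpos : ∀ v ∈ φ.target, 0 < density c v := fun v hv ↦ density_pos (hE _) hv (hU _)
  have hSm : MeasurableSet φ.source := φ.open_source.measurableSet
  have htm : MeasurableSet φ.target := φ.open_target.measurableSet
  have hrestr := restrict_riemannianVolume hfr c
  have hgcont : ContinuousOn g φ.source := by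
    have h1 : ContinuousOn (fun v ↦ euclDiv Y v / density c v) φ.target :=
      hdc.continuousOn.div (continuousOn_density hfr c) fun v hv ↦ (hwpos v hv).ne'
    refine (h1.comp φ.continuousOn φ.mapsTo).congr fun x hx ↦ ?_
    have hx' := φ.map_source hx
    simp only [Function.comp]
    rw [hdivt _ hx', φ.left_inv hx, mul_div_cancel_left₀ _ (hwpos _ hx').ne']
  have hgm : AEStronglyMeasurable g (chartVolume (m := m) c) := by
    rw [← hrestr]
    exact hgcont.aestronglyMeasurable hSm
  have hwm : AEMeasurable (fun v ↦ ENNReal.ofReal (density c v))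
      ((volume : Measure (EuclideanSpace ℝ (Fin m))).restrict φ.target) :=
    ((continuousOn_density hfr c).aemeasurable htm).ennreal_ofReal
  have hpull : ∀ᵐ v ∂((volume : Measure (EuclideanSpace ℝ (Fin m))).restrict φ.target),
      (ENNReal.ofReal (density c v)).toReal • g (φ.symm v) = euclDiv Y v := by
    refine (ae_restrict_iff' htm).2 (.of_forall fun v hv ↦ ?_)
    rw [hdivt v hv, ENNReal.toReal_ofReal (hwpos v hv).le, smul_eq_mul]
  have hsymm := aemeasurable_chart_symm_withDensity (m := m) c
  have hsupp : Function.support g ⊆ φ.source := fun x hx ↦ by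
    by_contra h
    exact hx (hg0 x h)
  constructor
  · rw [← integrableOn_iff_integrable_of_support_subset hsupp, IntegrableOn, hrestr]
    refine (integrable_map_measure hgm hsymm).2 ?_
    refine (integrable_withDensity_iff_integrable_smul₀' hwm (by simp)).2 ?_
    exact (hdi.restrict (s := φ.target)).congr (hpull.mono fun v hv ↦ hv.symm)
  · rw [← setIntegral_eq_integral_of_forall_compl_eq_zero hg0, hrestr]
    refine (integral_map hsymm hgm).trans ?_
    rw [integral_withDensity_eq_integral_toReal_smul₀ hwm (by simp), integral_congr_ae hpull,
      setIntegral_eq_integral_of_forall_compl_eq_zero hdiv0, hd0]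

/-- The divergence theorem on a closed Riemannian manifold: the divergence of a smooth field,
computed in a smooth orthonormal frame around each point, has integral zero. -/
theorem integral_divAlong (hU : ∀ x, x ∈ U x) (hE : ∀ x, IsFrame (U x) (E x))
    (hX : SmoothOn X Set.univ) :
    Integrable (fun x ↦ divAlong (E x) X x) (riemannianVolume m M) ∧
      ∫ x, divAlong (E x) X x ∂(riemannianVolume m M) = 0 := by
  obtain ⟨ρ, hρ⟩ := SmoothPartitionOfUnity.exists_isSubordinate_chartAt_source (𝓡 m) M
  have hfin : {i | (Function.support (ρ i)).Nonempty}.Finite :=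
    ρ.locallyFinite.finite_nonempty_of_compact
  set t := hfin.toFinset with ht
  have hsum : ∀ x, ∑ i ∈ t, ρ i x = 1 := by
    intro x
    rw [← ρ.sum_eq_one (Set.mem_univ x)]
    refine (finsum_eq_sum_of_support_subset _ fun i hi ↦ ?_).symm
    simp only [ht, Set.Finite.coe_toFinset]
    exact ⟨x, hi⟩
  have hρd : ∀ i x, MDifferentiableAt (𝓡 m) 𝓘(ℝ) (ρ i) x := fun i x ↦
    (ρ i).contMDiff.mdifferentiableAt (by simp)
  have hD : (fun x ↦ divAlong (E x) X x) =
      fun x ↦ ∑ i ∈ t, (ρ i x * divAlong (E x) X x + dirDeriv X (ρ i) x) := by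
    funext x
    rw [Finset.sum_add_distrib, ← Finset.sum_mul, hsum, one_mul,
      ← dirDeriv_sum t fun i _ ↦ hρd i x,
      dirDeriv_eq_zero_of_eventually_const (c := 1) (.of_forall hsum), add_zero]
  have key := fun i ↦ integral_mul_divAlong_add_dirDeriv hU hE hX i (ρ i).contMDiff (hρ i)
  rw [hD]
  refine ⟨integrable_finsetSum _ fun i _ ↦ (key i).1, ?_⟩
  rw [integral_finsetSum _ fun i _ ↦ (key i).1]
  exact Finset.sum_eq_zero fun i _ ↦ (key i).2

end DivergenceTheorem

/-! ### The integral formula -/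

section IntegralFormula

/-- `∇_X X` does not change, locally, if `X` is multiplied by a function with values in `±1`. -/
theorem nabla_self_eq_of_eq_or_neg {m : ℕ} {M : Type*} [TopologicalSpace M]
    [ChartedSpace (EuclideanSpace ℝ (Fin m)) M]
    [RiemannianBundle (fun x : M ↦ TangentSpace (𝓡 m) x)] [IsManifold (𝓡 m) ∞ M]
    [IsContMDiffRiemannianBundle (𝓡 m) ∞ (EuclideanSpace ℝ (Fin m))
      (fun x : M ↦ TangentSpace (𝓡 m) x)] {X Y : VField m M} {V : Set M} {x : M} (hV : IsOpen V)
    (hX : SmoothOn X V) (hY : SmoothOn Y V) (hY1 : ∀ y ∈ V, ip Y Y y = 1)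
    (h : ∀ y ∈ V, X y = Y y ∨ X y = -Y y) (hx : x ∈ V) : nabla X X x = nabla Y Y x := by
  -- The sign is `⟨X, Y⟩`, which is continuous.
  have hcont : ContinuousAt (ip X Y) x := (hX.ip hY).continuousOn.continuousAt (hV.mem_nhds hx)
  have hval : ∀ y ∈ V, (X y = Y y → ip X Y y = 1) ∧ (X y = -Y y → ip X Y y = -1) := by
    intro y hy
    have h1 : inner ℝ (Y y) (Y y) = (1 : ℝ) := hY1 y hy
    constructor
    · intro h2
      simp only [ip]
      rw [h2, h1]
    · intro h2
      simp only [ip]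
      rw [h2, inner_neg_left, h1]
  rcases h x hx with hx1 | hx1
  · have hpos : 0 < ip X Y x := by rw [(hval x hx).1 hx1]; norm_num
    have hev : ∀ᶠ y in 𝓝 x, X y = Y y := by
      filter_upwards [hcont.tendsto.eventually_const_lt hpos, hV.mem_nhds hx] with y hy hyV
      rcases h y hyV with h1 | h1
      · exact h1
      · rw [(hval y hyV).2 h1] at hy
        norm_num at hy
    exact nabla_congr hev hev
  · have hneg : ip X Y x < 0 := by rw [(hval x hx).2 hx1]; norm_num
    have hev : ∀ᶠ y in 𝓝 x, X y = (-Y) y := by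
      filter_upwards [hcont.tendsto.eventually_lt_const hneg, hV.mem_nhds hx] with y hy hyV
      rcases h y hyV with h1 | h1
      · rw [(hval y hyV).1 h1] at hy
        norm_num at hy
      · exact h1
    rw [nabla_congr hev hev]
    exact nabla_neg_neg (hY.diffAt hV hx)

end IntegralFormula

end RiemFol

end

theorem theorem5 {n p : ℕ} {M : Type*} [TopologicalSpace M] [T2Space M] [CompactSpace M]
    [ChartedSpace (EuclideanSpace ℝ (Fin (n + p))) M] [IsManifold (𝓡 (n + p)) ∞ M]
    [MeasurableSpace M] [BorelSpace M]
    [RiemannianBundle (fun x : M ↦ TangentSpace (𝓡 (n + p)) x)]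
    [IsContMDiffRiemannianBundle (𝓡 (n + p)) ∞ (EuclideanSpace ℝ (Fin (n + p)))
      (fun x : M ↦ TangentSpace (𝓡 (n + p)) x)]
    (F : RiemFol.Foliation (n + p) n p M) (G : RiemFol.Foliation (n + p) p n M)
    (hFG : F.Orthogonal G) (α : Fin p)
    (U : M → Set M) (hU : ∀ x, x ∈ U x)
    (e : M → Fin n → RiemFol.VField (n + p) M) (u : M → Fin p → RiemFol.VField (n + p) M)
    (hframe : ∀ x, RiemFol.IsAdaptedFrame F G (U x) (e x) (u x))
    (hα : ∀ x y, ∀ z ∈ U x ∩ U y, u x α z = u y α z ∨ u x α z = -u y α z) :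
    Integrable (fun x ↦ RiemFol.integrand (e x) (u x) α x)
        (RiemFol.riemannianVolume (n + p) M) ∧
      ∫ x, RiemFol.integrand (e x) (u x) α x ∂(RiemFol.riemannianVolume (n + p) M) = 0 := by
  -- The globally defined field `∇_{e_α} e_α`.
  set X : RiemFol.VField (n + p) M := fun x ↦ RiemFol.nabla (u x α) (u x α) x with hX
  have hE : ∀ x, RiemFol.IsFrame (U x) (Fin.append (e x) (u x)) := fun x ↦ (hframe x).isFrame
  have hXU : ∀ x, ∀ y ∈ U x, X y = RiemFol.nabla (u x α) (u x α) y := by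
    intro x y hy
    refine RiemFol.nabla_self_eq_of_eq_or_neg (V := U y ∩ U x)
      ((hframe y).isOpen.inter (hframe x).isOpen)
      (ContMDiffOn.mono ((hframe y).smooth_u α) Set.inter_subset_left)
      (ContMDiffOn.mono ((hframe x).smooth_u α) Set.inter_subset_right)
      (fun z hz ↦ ?_) (hα y x) ⟨hU y, hy⟩
    simpa using (hframe x).inner_u α α z hz.2
  have hXs : RiemFol.SmoothOn X Set.univ := by
    intro x _
    have h1 : RiemFol.SmoothOn X (U x) :=
      (RiemFol.SmoothOn.nabla (hE x) ((hframe x).smooth_u α) ((hframe x).smooth_u α)).congr (hXU x)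
    exact (h1.contMDiffAt (hframe x).isOpen (hU x)).contMDiffWithinAt
  have hint : (fun x ↦ RiemFol.integrand (e x) (u x) α x) =
      fun x ↦ -RiemFol.divAlong (Fin.append (e x) (u x)) X x := by
    funext x
    rw [(hframe x).integrand_eq hFG α (hU x)]
    simp only [RiemFol.divAlong, RiemFol.ip]
    congr 1
    refine Finset.sum_congr rfl fun a _ ↦ ?_
    rw [RiemFol.nabla_congr (Y' := X) (.of_forall fun _ ↦ rfl)]
    exact Filter.mem_of_superset ((hframe x).isOpen.mem_nhds (hU x)) fun y hy ↦ (hXU x y hy).symm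
  obtain ⟨h1, h2⟩ := RiemFol.integral_divAlong hU hE hXs
  rw [hint]
  exact ⟨h1.neg, by rw [integral_neg, h2, neg_zero]⟩
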